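/- For an $n\times n$ matrix $M=[m_{ij}]$ over a (possibly non-commutative) ring, define the Chen determinant $$\mathrm{cdet}(M)=\sum_{\sigma\in S_n}(-1)^{n-r}M_{\sigma_1}M_{\sigma_2}\cdots M_{\sigma_r},$$ where $\sigma=\sigma_1\cdots\sigma_r$ is the factorization of $\sigma$ into disjoint cycles (fixed points counted as cycles of length one), each cycle is written as $(c_1c_2\cdots c_k)$, meaning $\sigma(c_l)=c_{l+1}$ and $\sigma(c_k)=c_1$, with $c_1$ its largest element, the cycles are ordered by decreasing first elements, and $M_{(c_1\cdots c_k)}=m_{c_1c_2}m_{c_2c_3}\cdots m_{c_{k-1}c_k}m_{c_kc_1}$. Let $M^\dagger$ be the conjugate transpose of a quaternionic matrix $M$. Let $M_{\langle i\rangle}$ be $M$ with its $i$-th and $n$-th columns exchanged, and let $M_{\langle i,j\rangle}$ be the matrix obtained from $M$ by replacing the $i$-th column by the $n$-th column and then the $n$-th column by the $j$-th standard basis vector. A KdV-Darboux kernel is a finite family $\Phi=\{\phi_1,\dots,\phi_n\}$, $n\ge 1$, of infinitely differentiable functions $\phi_i:\mathbb{R}^2\to\mathbb{H}$ of $(x,t)$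 such that 1. (dispersion) $\partial_x^3\phi_i=\partial_t\phi_i$ for all $i$; 2. (closure) for each $i$ there are constants $\alpha_1,\dots,\alpha_n\in\mathbb{H}$ with $\partial_x^2\phi_i=\sum_{j}\phi_j\alpha_j$ on $\mathbb{R}^2$; 3. (independence) for the Wronskian matrix $W=[\omega_{ij}]$, $\omega_{ij}=\partial_x^{i-1}\phi_j$, the function $\mathrm{cdet}(W^\dagger W)$ is not identically zero. **Theorem.** Let $\Phi=\{\phi_1,\dots,\phi_n\}$ be a KdV-Darboux kernel with Wronskian matrix $W$, and let $U\subseteq\mathbb{R}^2$ be the set of points where $\mathrm{cdet}(W^\dagger W)\ne 0$. Then $U$ is open, the expression in brackets below and the function $$u_\Phi(x,t)=\left[\frac{2}{\mathrm{cdet}(W^\dagger W)}\sum_{i=1}^n\frac{\partial^n\phi_i}{\partial x^n}\,\mathrm{cdet}\!\left(W_{\langle i\rangle}^\dagger W_{\langle i,n\rangle}\right)\right]_x$$ are infinitely differentiable on $U$, and $u=u_\Phi$ satisfies the non-commutative KdV equation $$u_t=\tfrac34uu_x+\tfrac34u_xu+\tfrac14u_{xxx}$$ at every point of $U$. If $n=1$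 and $\Phi=\{\phi\}$, then $U=\{\phi\neq0\}$ and on $U$ $$u_\Phi=2\phi_{xx}\phi^{-1}-2\phi_x\phi^{-1}\phi_x\phi^{-1}.$$ -/

import Mathlib

open scoped Quaternion ContDiff Matrix

namespace QKdV

section ChenDeterminant

/-- `c` is the first entry of a normalized cycle of `σ`: it is the largest element of the cycle
of `σ` through `c` (fixed points of `σ` count as cycles of length one). -/
def IsCycleLeader {n : ℕ} (σ : Equiv.Perm (Fin n)) (c : Fin n) : Prop :=
  ∀ j, σ.SameCycle c j → j ≤ c

open Classical in
/-- The first entries of the normalized cycles of `σ`, in decreasing order. -/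
noncomputable def cycleLeaders {n : ℕ} (σ : Equiv.Perm (Fin n)) : List (Fin n) :=
  (List.finRange n).reverse.filter (fun c => decide (IsCycleLeader σ c))

/-- The ordered product `m_{c₁c₂} m_{c₂c₃} ⋯ m_{c_k c₁}` along the cycle
`(c₁ c₂ ⋯ c_k)` of `σ` that starts at `c₁ = c`, so that `c_{l+1} = σ^l c`. -/
noncomputable def cycleProd {R : Type*} [Ring R] {n : ℕ} (M : Matrix (Fin n) (Fin n) R)
    (σ : Equiv.Perm (Fin n)) (c : Fin n) : R :=
  ((List.range (Function.minimalPeriod σ c)).map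
    (fun l => M ((σ ^ l) c) ((σ ^ (l + 1)) c))).prod

/-- The Chen determinant
`cdet M = ∑_σ (-1)^{n-r} M_{σ₁} M_{σ₂} ⋯ M_{σ_r}`, where `σ = σ₁ ⋯ σ_r` is the factorization
into normalized cycles, ordered by decreasing first entries. -/
noncomputable def cdet {R : Type*} [Ring R] {n : ℕ} (M : Matrix (Fin n) (Fin n) R) : R :=
  ∑ σ : Equiv.Perm (Fin n),
    (-1) ^ (n - (cycleLeaders σ).length) * ((cycleLeaders σ).map (cycleProd M σ)).prod

/-- `M_{⟨i⟩}`: the matrix `M` with its `i`-th and its last column exchanged. -/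
def swapLast {R : Type*} {m : ℕ} (M : Matrix (Fin (m + 1)) (Fin (m + 1)) R)
    (i : Fin (m + 1)) : Matrix (Fin (m + 1)) (Fin (m + 1)) R :=
  Matrix.of fun a b => M a (Equiv.swap i (Fin.last m) b)

/-- `M_{⟨i,j⟩}`: the `i`-th column of `M` is replaced by its last column, and then the last
column is replaced by the standard basis vector `e_j`. -/
def replaceLast {R : Type*} [Ring R] {m : ℕ} (M : Matrix (Fin (m + 1)) (Fin (m + 1)) R)
    (i j : Fin (m + 1)) : Matrix (Fin (m + 1)) (Fin (m + 1)) R :=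
  (M.updateCol i (fun a => M a (Fin.last m))).updateCol (Fin.last m) (Pi.single j 1)

end ChenDeterminant

section Kernels

/-- The partial derivative `∂ᵏf/∂xᵏ` of a function `f(x, t)`, at `(x, t)`. -/
noncomputable def dx (k : ℕ) (f : ℝ → ℝ → ℍ[ℝ]) (x t : ℝ) : ℍ[ℝ] :=
  iteratedDeriv k (fun y => f y t) x

/-- The partial derivative `∂f/∂t` of a function `f(x, t)`, at `(x, t)`. -/
noncomputable def dt (f : ℝ → ℝ → ℍ[ℝ]) (x t : ℝ) : ℍ[ℝ] :=
  deriv (fun s => f x s) t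

/-- The Wronskian matrix: the entry in row `i` and column `j` (both counted from `0`) is
`∂ⁱφ_j/∂xⁱ`. -/
noncomputable def wronskian {n : ℕ} (Φ : Fin n → ℝ → ℝ → ℍ[ℝ]) (x t : ℝ) :
    Matrix (Fin n) (Fin n) ℍ[ℝ] :=
  Matrix.of fun i j => dx (i : ℕ) (Φ j) x t

/-- The function `cdet(W† W)` of a family of functions with Wronskian matrix `W`. -/
noncomputable def wronskianCdet {n : ℕ} (Φ : Fin n → ℝ → ℝ → ℍ[ℝ]) (x t : ℝ) : ℍ[ℝ] :=
  cdet ((wronskian Φ x t)ᴴ * wronskian Φ x t)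

/-- KdV-Darboux kernels: families of smooth quaternion-valued functions on `ℝ²` with the
dispersion, closure and independence properties. -/
structure IsKdVDarbouxKernel {n : ℕ} (Φ : Fin n → ℝ → ℝ → ℍ[ℝ]) : Prop where
  smooth : ∀ i, ContDiff ℝ ∞ (fun p : ℝ × ℝ => Φ i p.1 p.2)
  dispersion : ∀ i x t, dx 3 (Φ i) x t = dt (Φ i) x t
  closure : ∀ i, ∃ α : Fin n → ℍ[ℝ], ∀ x t, dx 2 (Φ i) x t = ∑ j, Φ j x t * α j
  independence : ∃ x t, wronskianCdet Φ x t ≠ 0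

/-- The set of points of `ℝ²` at which `cdet(W† W)` does not vanish. -/
def regularSet {n : ℕ} (Φ : Fin n → ℝ → ℝ → ℍ[ℝ]) : Set (ℝ × ℝ) :=
  {p | wronskianCdet Φ p.1 p.2 ≠ 0}

/-- With `n = m + 1` functions, the expression
`(2 / cdet(W† W)) ∑ᵢ (∂ⁿφᵢ/∂xⁿ) cdet(W_{⟨i⟩}† W_{⟨i,n⟩})`. -/
noncomputable def chenExpression {m : ℕ} (Φ : Fin (m + 1) → ℝ → ℝ → ℍ[ℝ]) (x t : ℝ) : ℍ[ℝ] :=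
  2 * (wronskianCdet Φ x t)⁻¹ *
    ∑ i, dx (m + 1) (Φ i) x t *
      cdet ((swapLast (wronskian Φ x t) i)ᴴ * replaceLast (wronskian Φ x t) i (Fin.last m))

/-- The function `u_Φ`, the `x`-derivative of `chenExpression Φ`. -/
noncomputable def uPhi {m : ℕ} (Φ : Fin (m + 1) → ℝ → ℝ → ℍ[ℝ]) (x t : ℝ) : ℍ[ℝ] :=
  dx 1 (chenExpression Φ) x t

/-- `u` solves `u_t = (3/4) u u_x + (3/4) u_x u + (1/4) u_xxx` classically on the open set `U`,
with all the derivatives existing since `u` is smooth there. -/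
structure IsKdVSolutionOn (u : ℝ → ℝ → ℍ[ℝ]) (U : Set (ℝ × ℝ)) : Prop where
  isOpen : IsOpen U
  smooth : ContDiffOn ℝ ∞ (fun p : ℝ × ℝ => u p.1 p.2) U
  equation : ∀ x t, (x, t) ∈ U →
    dt u x t = (3 / 4 : ℝ) • (u x t * dx 1 u x t) + (3 / 4 : ℝ) • (dx 1 u x t * u x t)
      + (1 / 4 : ℝ) • dx 3 u x t

end Kernels

end QKdV

/-! The analysis takes place in the algebra of quaternionic matrices. Closure and dispersion,
differentiated in `x`, give `W_xx = WΛ` with `Λ` constant, and `W_t = W_xxx`. Put `X = W_x W⁻¹` and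
`Q = X_x + X²`. Then `QW = WΛ`, so `Q_x = XQ - QX`, which is `X_xx = -2 X_x X`; differentiating `XW
= W_x` in `t` gives `X_t = X_x Q`. Together these yield `4X_t = X_xxx + 6X_x²`
(`potential_kdv_of_linear`). Every row of `W_x` but the last is the next row of `W`, so every row of
`X` but the last is constant. Hence the last diagonal entry of `X_x²` is the square of that of
`X_x`, and the entry `a = X_nn` satisfies the same equation over the quaternions. One more
`x`-derivative shows that `2a_x` solves KdV.

It remains to identify the bracketed expression with `2a`, that is, to prove `cdet(W_⟨i⟩† W_⟨i,n⟩) =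
cdet(W†W) (W⁻¹)_in` (`cdet_swapLast_mul_replaceLast`). This is Cramer's rule for a Hermitian matrix.
It rests on two facts about the Chen determinant of a Hermitian quaternionic matrix: it is real,
hence central, and the cycle opened first may start at any index instead of the largest
(`principalDet_hermitian`). Both are proved in one induction on the index set. With `K` the adjugate
built from simple paths and `d_a` the expansion at `a`, both `KH` and `HK` are diagonal with entries
`d_a`; comparing `(HK)H` with `H(KH)` gives `d_a h_ab = h_ab d_b`, and a perturbation of `h_ab`
removes the case `h_ab = 0`. -/

namespace QKdV

/-! ### Sums over permutations as sums over simple paths -/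

section PathExpansion

/-- The signed sum, over all simple paths that start at `i` and continue in `S`, of the ordered
products of entries of `M` along the path, closed up by the entry of `v` at the end of the path,
and multiplied by the Chen determinant of the remaining principal submatrix. -/
noncomputable def pathSum {R ι : Type*} [Ring R] [LinearOrder ι] (M : Matrix ι ι R) (v : ι → R)
    (S : Finset ι) (i : ι) : R :=
  v i * (if h : S.Nonempty then
      pathSum M (fun k => M k (S.max' h)) (S.erase (S.max' h)) (S.max' h) else 1)
    - ∑ j ∈ S.attach, M i j * pathSum M v (S.erase j) j
termination_by S.card
decreasing_by
  · exact Finset.card_erase_lt_of_mem (S.max'_mem h)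
  · exact Finset.card_erase_lt_of_mem j.2

/-- The Chen determinant of the principal submatrix of `M` with rows and columns in `S`, expanded
along the cycle through the largest element of `S`. -/
noncomputable def principalDet {R ι : Type*} [Ring R] [LinearOrder ι] (M : Matrix ι ι R)
    (S : Finset ι) : R :=
  if h : S.Nonempty then
    pathSum M (fun k => M k (S.max' h)) (S.erase (S.max' h)) (S.max' h) else 1

theorem pathSum_eq {R ι : Type*} [Ring R] [LinearOrder ι] (M : Matrix ι ι R) (v : ι → R)
    (S : Finset ι) (i : ι) :
    pathSum M v S i =
      v i * principalDet M S - ∑ j ∈ S, M i j * pathSum M v (S.erase j) j := by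
  rw [pathSum, principalDet, ← Finset.sum_attach S]

theorem principalDet_empty {R ι : Type*} [Ring R] [LinearOrder ι] (M : Matrix ι ι R) :
    principalDet M ∅ = 1 := by
  simp [principalDet]

theorem principalDet_of_nonempty {R ι : Type*} [Ring R] [LinearOrder ι] (M : Matrix ι ι R)
    {S : Finset ι} (h : S.Nonempty) :
    principalDet M S =
      pathSum M (fun k => M k (S.max' h)) (S.erase (S.max' h)) (S.max' h) := by
  rw [principalDet, dif_pos h]

/-- The signed product of entries of `M` read off along the cycle of `σ` which started at `c` and
has arrived at `i`, and then along the cycles of `σ` through the remaining elements `S`. -/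
noncomputable def traverse {R ι : Type*} [Ring R] [LinearOrder ι] (M : Matrix ι ι R)
    (σ : Equiv.Perm ι) (c : ι) (S : Finset ι) (i : ι) : R :=
  if σ i = c then
    M i c * (if h : S.Nonempty then
      traverse M σ (S.max' h) (S.erase (S.max' h)) (S.max' h) else 1)
  else if σ i ∈ S then -(M i (σ i) * traverse M σ c (S.erase (σ i)) (σ i)) else 0
termination_by S.card
decreasing_by
  · exact Finset.card_erase_lt_of_mem (S.max'_mem h)
  · exact Finset.card_erase_lt_of_mem ‹_›

/-- The signed product of entries of `M` along the normalized cycles of `σ` in `S`. -/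
noncomputable def traverseFrom {R ι : Type*} [Ring R] [LinearOrder ι] (M : Matrix ι ι R)
    (σ : Equiv.Perm ι) (S : Finset ι) : R :=
  if h : S.Nonempty then traverse M σ (S.max' h) (S.erase (S.max' h)) (S.max' h) else 1

theorem traverse_of_eq {R ι : Type*} [Ring R] [LinearOrder ι] (M : Matrix ι ι R)
    {σ : Equiv.Perm ι} {c : ι} (S : Finset ι) {i : ι} (h : σ i = c) :
    traverse M σ c S i = M i c * traverseFrom M σ S := by
  rw [traverse, traverseFrom, if_pos h]

theorem traverse_of_mem {R ι : Type*} [Ring R] [LinearOrder ι] (M : Matrix ι ι R)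
    {σ : Equiv.Perm ι} {c : ι} {S : Finset ι} {i : ι} (h : σ i ≠ c) (hS : σ i ∈ S) :
    traverse M σ c S i = -(M i (σ i) * traverse M σ c (S.erase (σ i)) (σ i)) := by
  rw [traverse, if_neg h, if_pos hS]

/-- The permutations which agree with `τ` outside of `S`. -/
noncomputable def permsAgreeing {ι : Type*} [Fintype ι] [DecidableEq ι] (τ : Equiv.Perm ι)
    (S : Finset ι) : Finset (Equiv.Perm ι) :=
  Finset.univ.filter fun σ => ∀ x, x ∉ S → σ x = τ x

theorem mem_permsAgreeing {ι : Type*} [Fintype ι] [DecidableEq ι] {τ σ : Equiv.Perm ι}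
    {S : Finset ι} : σ ∈ permsAgreeing τ S ↔ ∀ x, x ∉ S → σ x = τ x := by
  simp [permsAgreeing]

theorem permsAgreeing_empty {ι : Type*} [Fintype ι] [DecidableEq ι] (τ : Equiv.Perm ι) :
    permsAgreeing τ ∅ = {τ} := by
  ext σ
  simp [mem_permsAgreeing, Equiv.ext_iff]

theorem permsAgreeing_univ {ι : Type*} [Fintype ι] [DecidableEq ι] (τ : Equiv.Perm ι) :
    permsAgreeing τ Finset.univ = Finset.univ := by
  ext σ
  simp [mem_permsAgreeing]

theorem image_eq_of_agree {ι : Type*} [Fintype ι] [DecidableEq ι] {τ σ : Equiv.Perm ι}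
    {S T : Finset ι} (hτ : ∀ x, x ∈ S ↔ τ x ∈ T) (hσ : ∀ x, x ∉ S → σ x = τ x) (x : ι) :
    x ∈ S ↔ σ x ∈ T := by
  constructor
  · intro hx
    by_contra hT
    have h1 : τ.symm (σ x) ∉ S := by rwa [hτ, Equiv.apply_symm_apply]
    have h2 := hσ _ h1
    rw [Equiv.apply_symm_apply] at h2
    rw [σ.injective h2] at h1
    exact h1 hx
  · intro hx
    by_contra hS
    rw [hσ x hS, ← hτ] at hx
    exact hS hx

theorem swap_mul_mem_iff {ι : Type*} [DecidableEq ι] {τ : Equiv.Perm ι} {S T : Finset ι} {i j : ι}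
    (hi : i ∉ S) (hj : j ∈ T) (hτ : ∀ x, x ∈ insert i S ↔ τ x ∈ T) (x : ι) :
    x ∈ S ↔ (Equiv.swap j (τ i) * τ) x ∈ T.erase j := by
  have hiT : τ i ∈ T := (hτ i).1 (by simp)
  rw [Equiv.Perm.mul_apply, Finset.mem_erase]
  by_cases hxi : x = i
  · subst hxi; simp [hi]
  have hne : τ x ≠ τ i := fun h => hxi (τ.injective h)
  by_cases hxj : τ x = j
  · rw [hxj, Equiv.swap_apply_left]
    have : x ∈ insert i S := by rw [hτ, hxj]; exact hj
    simp only [Finset.mem_insert, hxi, false_or] at this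
    simp only [this, hiT, true_iff, and_true]
    rw [← hxj]; exact hne.symm
  · rw [Equiv.swap_apply_of_ne_of_ne hxj hne]
    have := hτ x
    simp only [Finset.mem_insert, hxi, false_or] at this
    simp [this, hxj]

/-- Sort the permutations by the value `j` at `i`. The fibre over `j` is again a class of
permutations prescribed outside `S`, with `τ` corrected by a transposition so as to send `i` to `j`.
-/
theorem sum_permsAgreeing_insert {R ι : Type*} [AddCommMonoid R] [Fintype ι] [DecidableEq ι]
    (F : Equiv.Perm ι → R) {τ : Equiv.Perm ι} {S T : Finset ι} {i : ι}
    (hi : i ∉ S) (hτ : ∀ x, x ∈ insert i S ↔ τ x ∈ T) :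
    ∑ σ ∈ permsAgreeing τ (insert i S), F σ =
      ∑ j ∈ T, ∑ σ ∈ permsAgreeing (Equiv.swap j (τ i) * τ) S, F σ := by
  have hmap : ∀ σ ∈ permsAgreeing τ (insert i S), σ i ∈ T := fun σ hσ =>
    (image_eq_of_agree hτ (mem_permsAgreeing.1 hσ) i).1 (by simp)
  rw [← Finset.sum_fiberwise_of_maps_to hmap]
  refine Finset.sum_congr rfl fun j hj => Finset.sum_congr ?_ fun _ _ => rfl
  ext σ
  rw [Finset.mem_filter, mem_permsAgreeing, mem_permsAgreeing]
  have key : ∀ x, x ∉ insert i S → (Equiv.swap j (τ i) * τ) x = τ x := by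
    intro x hx
    rw [Equiv.Perm.mul_apply, Equiv.swap_apply_of_ne_of_ne]
    · rintro rfl; exact hx ((hτ x).2 hj)
    · intro h; exact hx (by simp [τ.injective h])
  constructor
  · rintro ⟨h, rfl⟩ x hx
    by_cases hxi : x = i
    · subst hxi; simp
    · rw [key x (by simp [hx, hxi]), h x (by simp [hx, hxi])]
  · intro h
    refine ⟨fun x hx => ?_, ?_⟩
    · rw [h x (fun hS => hx (by simp [hS])), key x hx]
    · rw [h i hi]; simp

/-- The first statement sums over complete permutations of `S`, the second over completions of a
cycle opened at `c` that has reached `i`. Each calls the other: opening a cycle at the maximum of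
`S` leads to the second; there, the value `c` at `i` closes the cycle and returns to the first,
while a value `j` in `S` lengthens the path. -/
theorem sum_traverse {R ι : Type*} [Ring R] [LinearOrder ι] [Fintype ι] (M : Matrix ι ι R) (k : ℕ) :
    ∀ (S : Finset ι), S.card = k →
      (∀ τ : Equiv.Perm ι, (∀ x, x ∈ S ↔ τ x ∈ S) →
        ∑ σ ∈ permsAgreeing τ S, traverseFrom M σ S = principalDet M S) ∧
      (∀ (τ : Equiv.Perm ι) (i c : ι), i ∉ S → c ∉ S →
        (∀ x, x ∈ insert i S ↔ τ x ∈ insert c S) →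
        ∑ σ ∈ permsAgreeing τ (insert i S), traverse M σ c S i =
          pathSum M (fun k => M k c) S i) := by
  induction k using Nat.strong_induction_on with
  | _ k ih =>
  intro S hS
  have hA : ∀ τ : Equiv.Perm ι, (∀ x, x ∈ S ↔ τ x ∈ S) →
      ∑ σ ∈ permsAgreeing τ S, traverseFrom M σ S = principalDet M S := by
    intro τ hτ
    by_cases h : S.Nonempty
    · have hm := S.max'_mem h
      have := (ih _ (hS ▸ Finset.card_erase_lt_of_mem hm) (S.erase (S.max' h)) rfl).2 τ
        (S.max' h) (S.max' h) (by simp) (by simp) (by rwa [Finset.insert_erase hm])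
      rw [Finset.insert_erase hm] at this
      simp only [traverseFrom, dif_pos h]
      rw [this, principalDet_of_nonempty]
    · rw [Finset.not_nonempty_iff_eq_empty] at h
      subst h
      rw [permsAgreeing_empty]
      simp [traverseFrom, principalDet]
  refine ⟨hA, fun τ i c hi hc hτ => ?_⟩
  rw [sum_permsAgreeing_insert _ hi hτ, Finset.sum_insert hc, pathSum_eq, sub_eq_add_neg,
    ← Finset.sum_neg_distrib]
  congr 1
  · have hc' : ∀ x, x ∈ S ↔ (Equiv.swap c (τ i) * τ) x ∈ S := by
      have := swap_mul_mem_iff hi (Finset.mem_insert_self c S) hτ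
      rwa [Finset.erase_insert hc] at this
    rw [← hA _ hc', Finset.mul_sum]
    refine Finset.sum_congr rfl fun σ hσ => traverse_of_eq _ _ ?_
    rw [mem_permsAgreeing.1 hσ i hi]; simp
  · refine Finset.sum_congr rfl fun j hj => ?_
    have hcj : c ≠ j := fun h => hc (h ▸ hj)
    have hj' : ∀ x, x ∈ S ↔ (Equiv.swap j (τ i) * τ) x ∈ insert c (S.erase j) := by
      have := swap_mul_mem_iff hi (Finset.mem_insert_of_mem hj) hτ
      rwa [Finset.erase_insert_of_ne hcj] at this
    have := (ih _ (hS ▸ Finset.card_erase_lt_of_mem hj) (S.erase j) rfl).2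
      (Equiv.swap j (τ i) * τ) j c (by simp) (by simp [hc]) (by rwa [Finset.insert_erase hj])
    rw [Finset.insert_erase hj] at this
    rw [← this, Finset.mul_sum, ← Finset.sum_neg_distrib]
    refine Finset.sum_congr rfl fun σ hσ => ?_
    have hσi : σ i = j := by rw [mem_permsAgreeing.1 hσ i hi]; simp
    rw [traverse_of_mem _ (by rw [hσi]; exact hcj.symm) (by rwa [hσi]), hσi]

end PathExpansion

/-! ### Identification of the path expansion with the Chen determinant -/

section CycleExpansion

open Classical in
/-- The first entries of the normalized cycles of `σ` in `S`, in decreasing order. -/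
noncomputable def leadersIn {n : ℕ} (σ : Equiv.Perm (Fin n)) (S : Finset (Fin n)) :
    List (Fin n) :=
  (List.finRange n).reverse.filter (fun c => decide (IsCycleLeader σ c ∧ c ∈ S))

theorem mem_leadersIn {n : ℕ} {σ : Equiv.Perm (Fin n)} {S : Finset (Fin n)} {c : Fin n} :
    c ∈ leadersIn σ S ↔ IsCycleLeader σ c ∧ c ∈ S := by
  simp [leadersIn]

theorem leadersIn_pairwise {n : ℕ} (σ : Equiv.Perm (Fin n)) (S : Finset (Fin n)) :
    (leadersIn σ S).Pairwise (· > ·) := by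
  refine List.Pairwise.filter _ ?_
  rw [List.pairwise_reverse]
  exact List.pairwise_lt_finRange n

theorem leadersIn_univ {n : ℕ} (σ : Equiv.Perm (Fin n)) :
    leadersIn σ Finset.univ = cycleLeaders σ := by
  unfold leadersIn cycleLeaders
  congr 1
  funext c
  simp

theorem mem_iff_of_sameCycle {ι : Type*} [Finite ι] {σ : Equiv.Perm ι} {S : Finset ι}
    (hS : ∀ x, x ∈ S ↔ σ x ∈ S) {x y : ι} (h : σ.SameCycle x y) : x ∈ S ↔ y ∈ S := by
  obtain ⟨k, hk, rfl⟩ := h.exists_pow_eq'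
  clear h hk
  induction k with
  | zero => simp
  | succ k ih => rw [ih, pow_succ', Equiv.Perm.mul_apply, ← hS]

/-- Both lists are strictly decreasing, so equality of their members suffices. The maximum of an
invariant set leads its own cycle, and no other leader lies on that cycle. -/
theorem leadersIn_cons {n : ℕ} {σ : Equiv.Perm (Fin n)} {S T : Finset (Fin n)} {d : Fin n}
    (hS : ∀ x, x ∈ S ↔ σ x ∈ S) (hd : d ∈ S) (hmax : ∀ x ∈ S, x ≤ d)
    (hT : ∀ x, x ∈ T ↔ x ∈ S ∧ ¬ σ.SameCycle d x) :
    leadersIn σ S = d :: leadersIn σ T := by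
  have hdl : IsCycleLeader σ d := fun j hj => hmax j ((mem_iff_of_sameCycle hS hj).1 hd)
  refine List.Pairwise.eq_of_mem_iff (leadersIn_pairwise σ S) ?_ fun x => ?_
  · rw [List.pairwise_cons]
    refine ⟨fun x hx => ?_, leadersIn_pairwise σ T⟩
    have hxT := (hT x).1 (mem_leadersIn.1 hx).2
    exact lt_of_le_of_ne (hmax x hxT.1) fun h => hxT.2 (h ▸ Equiv.Perm.SameCycle.refl _ _)
  · rw [List.mem_cons, mem_leadersIn, mem_leadersIn, hT]
    constructor
    · rintro ⟨hl, hx⟩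
      by_cases hc : σ.SameCycle d x
      · exact Or.inl (le_antisymm (hmax x hx) (hl d hc.symm))
      · exact Or.inr ⟨hl, hx, hc⟩
    · rintro (rfl | ⟨hl, hx, -⟩)
      · exact ⟨hdl, hd⟩
      · exact ⟨hl, hx⟩

theorem minimalPeriod_perm_pos {ι : Type*} [Finite ι] (σ : Equiv.Perm ι) (d : ι) :
    0 < Function.minimalPeriod σ d := by
  refine Function.IsPeriodicPt.minimalPeriod_pos (orderOf_pos σ) ?_
  rw [Function.IsPeriodicPt, Equiv.Perm.iterate_eq_pow, pow_orderOf_eq_one]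
  rfl

theorem pow_minimalPeriod_apply {ι : Type*} (σ : Equiv.Perm ι) (d : ι) :
    (σ ^ Function.minimalPeriod σ d) d = d := by
  rw [← Equiv.Perm.iterate_eq_pow]
  exact Function.iterate_minimalPeriod

theorem pow_apply_injOn {ι : Type*} (σ : Equiv.Perm ι) (d : ι) :
    Set.InjOn (fun m : ℕ => (σ ^ m) d) (Set.Iio (Function.minimalPeriod σ d)) := by
  simp only [← Equiv.Perm.iterate_eq_pow]
  exact Function.iterate_injOn_Iio_minimalPeriod

/-- The first `l` elements of the cycle of `σ` which starts at `d`. -/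
def visited {ι : Type*} [DecidableEq ι] (σ : Equiv.Perm ι) (d : ι) (l : ℕ) : Finset ι :=
  (Finset.range l).image fun m => (σ ^ m) d

theorem mem_visited_minimalPeriod {ι : Type*} [DecidableEq ι] [Finite ι] (σ : Equiv.Perm ι)
    (d x : ι) : x ∈ visited σ d (Function.minimalPeriod σ d) ↔ σ.SameCycle d x := by
  simp only [visited, Finset.mem_image, Finset.mem_range]
  constructor
  · rintro ⟨m, -, rfl⟩
    exact Equiv.Perm.sameCycle_pow_right.2 (Equiv.Perm.SameCycle.refl _ _)
  · intro h
    obtain ⟨k, _, rfl⟩ := h.exists_pow_eq'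
    refine ⟨k % Function.minimalPeriod σ d, Nat.mod_lt _ (minimalPeriod_perm_pos σ d), ?_⟩
    simp only [← Equiv.Perm.iterate_eq_pow]
    exact Function.iterate_mod_minimalPeriod_eq

theorem traverse_visited {R ι : Type*} [Ring R] [LinearOrder ι] [Finite ι] (M : Matrix ι ι R)
    {σ : Equiv.Perm ι} {S : Finset ι} {d : ι} (hS : ∀ x, x ∈ S ↔ σ x ∈ S) (hd : d ∈ S) (l : ℕ)
    (hl : l < Function.minimalPeriod σ d) :
    traverse M σ d (S.erase d) d =
      (-1) ^ l * ((List.range l).map fun m => M ((σ ^ m) d) ((σ ^ (m + 1)) d)).prod *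
        traverse M σ d (S \ visited σ d (l + 1)) ((σ ^ l) d) := by
  induction l with
  | zero =>
    have : S \ visited σ d 1 = S.erase d := by simp [visited, Finset.sdiff_singleton_eq_erase]
    simp [this]
  | succ l ih =>
    have hinj := pow_apply_injOn σ d
    have hne : ∀ m < l + 1, (σ ^ m) d ≠ (σ ^ (l + 1)) d := fun m hm h =>
      hm.ne (hinj (Set.mem_Iio.2 (hm.trans hl)) (Set.mem_Iio.2 hl) h)
    have hstep : σ ((σ ^ l) d) = (σ ^ (l + 1)) d := by
      rw [pow_succ', Equiv.Perm.mul_apply]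
    have hmem : (σ ^ (l + 1)) d ∈ S \ visited σ d (l + 1) := by
      rw [Finset.mem_sdiff]
      refine ⟨(mem_iff_of_sameCycle hS
        (Equiv.Perm.sameCycle_pow_right.2 (Equiv.Perm.SameCycle.refl _ _))).1 hd, ?_⟩
      simp only [visited, Finset.mem_image, Finset.mem_range, not_exists, not_and]
      exact hne
    have herase : (S \ visited σ d (l + 1)).erase ((σ ^ (l + 1)) d)
        = S \ visited σ d (l + 1 + 1) := by
      have : visited σ d (l + 1 + 1) = insert ((σ ^ (l + 1)) d) (visited σ d (l + 1)) := by
        unfold visited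
        rw [Finset.range_add_one, Finset.image_insert]
      rw [this]
      ext x
      simp only [Finset.mem_erase, Finset.mem_sdiff, Finset.mem_insert]
      tauto
    rw [ih (by omega), traverse_of_mem, hstep, herase, List.range_succ, List.map_append,
      List.prod_append, pow_succ]
    · simp only [List.map_cons, List.map_nil, List.prod_cons, List.prod_nil, mul_one]
      noncomm_ring
    · rw [hstep]
      exact (hne 0 (by omega)).symm
    · rwa [hstep]

/-- A cycle of length `q + 1` takes `q` steps before closing, each with a sign, so the total sign is
`(-1) ^ (card - r)` for `r` cycles. The factor for `r` stands on the left to avoid truncated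
subtraction. -/
theorem traverseFrom_eq {R : Type*} [Ring R] {n : ℕ} (M : Matrix (Fin n) (Fin n) R)
    (σ : Equiv.Perm (Fin n)) (k : ℕ) : ∀ S : Finset (Fin n), S.card = k →
      (∀ x, x ∈ S ↔ σ x ∈ S) →
      (-1) ^ (leadersIn σ S).length * traverseFrom M σ S =
        (-1) ^ S.card * ((leadersIn σ S).map (cycleProd M σ)).prod := by
  induction k using Nat.strong_induction_on with
  | _ k ih =>
  intro S hk hS
  by_cases h : S.Nonempty
  · set d := S.max' h with hd_def
    have hd : d ∈ S := S.max'_mem h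
    set p := Function.minimalPeriod σ d with hp
    have hp0 : 0 < p := minimalPeriod_perm_pos σ d
    set T := S \ visited σ d p with hT_def
    have hT : ∀ x, x ∈ T ↔ x ∈ S ∧ ¬ σ.SameCycle d x := fun x => by
      rw [hT_def, Finset.mem_sdiff, hp, mem_visited_minimalPeriod]
    have hTinv : ∀ x, x ∈ T ↔ σ x ∈ T := fun x => by
      rw [hT, hT, ← hS, Equiv.Perm.sameCycle_apply_right]
    have hVS : visited σ d p ⊆ S := fun x hx =>
      (mem_iff_of_sameCycle hS ((mem_visited_minimalPeriod σ d x).1 hx)).1 hd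
    have hcard : S.card = p + T.card := by
      have h1 : (visited σ d p).card = p := by
        unfold visited
        rw [Finset.card_image_of_injOn, Finset.card_range]
        intro a ha b hb hab
        exact pow_apply_injOn σ d (by simpa using ha) (by simpa using hb) hab
      have := Finset.card_sdiff_add_card_eq_card hVS
      rw [h1, ← hT_def] at this
      omega
    have hrec := ih T.card (by omega) T rfl hTinv
    have hlead := leadersIn_cons hS hd (fun x hx => S.le_max' x hx) hT
    obtain ⟨q, hq⟩ : ∃ q, p = q + 1 := ⟨p - 1, by omega⟩
    have hclose : σ ((σ ^ q) d) = d := by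
      rw [← Equiv.Perm.mul_apply, ← pow_succ', ← hq, hp, pow_minimalPeriod_apply]
    have hprod : cycleProd M σ d =
        ((List.range q).map fun m => M ((σ ^ m) d) ((σ ^ (m + 1)) d)).prod *
          M ((σ ^ q) d) d := by
      have hlast : (σ ^ (q + 1)) d = d := by rw [← hq, hp, pow_minimalPeriod_apply]
      rw [cycleProd, ← hp, hq, List.range_succ, List.map_append, List.prod_append]
      simp [hlast]
    have hstart : traverseFrom M σ S =
        (-1) ^ q * cycleProd M σ d * traverseFrom M σ T := by
      rw [traverseFrom, dif_pos h, ← hd_def,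
        traverse_visited M hS hd q (by omega), traverse_of_eq _ _ hclose, ← hq, hprod]
      simp only [mul_assoc]
      rfl
    rw [hlead, hcard, hq, hstart, List.map_cons, List.prod_cons, List.length_cons]
    have hcomm : ∀ (a : ℕ) (x : R), x * (-1) ^ a = (-1) ^ a * x := fun a x =>
      ((Commute.neg_one_left x).pow_left a).eq.symm
    calc (-1) ^ ((leadersIn σ T).length + 1) *
          ((-1) ^ q * cycleProd M σ d * traverseFrom M σ T)
        = (-1) ^ (q + 1) * cycleProd M σ d *
            ((-1) ^ (leadersIn σ T).length * traverseFrom M σ T) := by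
          rw [pow_succ (-1) q, pow_succ (-1)]
          have := hcomm (leadersIn σ T).length (cycleProd M σ d)
          have h2 := hcomm (leadersIn σ T).length ((-1 : R) ^ q)
          simp only [mul_assoc, mul_neg, neg_mul, mul_one]
          rw [← mul_assoc (cycleProd M σ d) ((-1) ^ _), this, mul_assoc ((-1) ^ _),
            ← mul_assoc ((-1) ^ q) ((-1) ^ _), h2, mul_assoc]
      _ = _ := by
          rw [hrec, pow_add (-1) (q + 1), mul_assoc, ← mul_assoc (cycleProd M σ d),
            hcomm, mul_assoc, mul_assoc]
  · rw [Finset.not_nonempty_iff_eq_empty] at h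
    subst h
    have : leadersIn σ ∅ = [] := List.eq_nil_iff_forall_not_mem.2 fun x hx => by
      simpa using (mem_leadersIn.1 hx).2
    simp [this, traverseFrom]

/-- The Chen determinant, expanded along the cycle through the last index. -/
theorem cdet_eq_principalDet {R : Type*} [Ring R] {n : ℕ} (M : Matrix (Fin n) (Fin n) R) :
    cdet M = principalDet M Finset.univ := by
  rw [← (sum_traverse M _ Finset.univ rfl).1 1 (by simp), permsAgreeing_univ, cdet]
  refine Finset.sum_congr rfl fun σ _ => ?_
  have h := traverseFrom_eq M σ _ Finset.univ rfl (by simp)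
  rw [leadersIn_univ, Finset.card_univ, Fintype.card_fin] at h
  have hle : (cycleLeaders σ).length ≤ n := by
    unfold cycleLeaders
    refine (List.length_filter_le _ _).trans ?_
    simp
  have h1 : (-1 : R) ^ n = (-1) ^ (cycleLeaders σ).length *
      (-1) ^ (n - (cycleLeaders σ).length) := by rw [← pow_add]; congr 1; omega
  rw [h1, mul_assoc] at h
  exact ((isUnit_one.neg.pow _).mul_left_cancel h).symm

end CycleExpansion

/-! ### Reality and base-point independence for Hermitian matrices -/

section Hermitian

theorem mul_comm_of_star_eq {x : ℍ[ℝ]} (h : star x = x) (y : ℍ[ℝ]) : x * y = y * x := by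
  rw [Quaternion.star_eq_self.1 h]
  exact Quaternion.coe_commutes _ _

theorem pathSum_eq_zero {R ι : Type*} [Ring R] [LinearOrder ι] (M : Matrix ι ι R) (v : ι → R)
    (S : Finset ι) (i : ι) (hv : ∀ k ∈ insert i S, v k = 0) : pathSum M v S i = 0 := by
  induction hc : S.card using Nat.strong_induction_on generalizing S i with
  | _ c ih =>
  rw [pathSum_eq, hv i (by simp), zero_mul, zero_sub, neg_eq_zero]
  refine Finset.sum_eq_zero fun j hj => ?_
  rw [ih _ (hc ▸ Finset.card_erase_lt_of_mem hj) _ j _ rfl, mul_zero]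
  intro k hk
  rw [Finset.insert_erase hj] at hk
  exact hv k (by simp [hk])

/-- The entries of the adjugate of the principal submatrix of `M` with rows and columns in `T`:
the signed sum over all simple paths in `T` from `i` to `k`. -/
noncomputable def adjEntry {R ι : Type*} [Ring R] [LinearOrder ι] (M : Matrix ι ι R)
    (T : Finset ι) (i k : ι) : R :=
  pathSum M (Pi.single k 1) (T.erase i) i

theorem adjEntry_self {R ι : Type*} [Ring R] [LinearOrder ι] (M : Matrix ι ι R) (T : Finset ι)
    (i : ι) : adjEntry M T i i = principalDet M (T.erase i) := by
  rw [adjEntry, pathSum_eq, Pi.single_eq_same, one_mul, sub_eq_self]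
  refine Finset.sum_eq_zero fun j hj => ?_
  rw [pathSum_eq_zero, mul_zero]
  intro k hk
  rw [Finset.insert_erase hj] at hk
  exact Pi.single_eq_of_ne (Finset.ne_of_mem_erase hk) _

theorem adjEntry_of_ne {R ι : Type*} [Ring R] [LinearOrder ι] (M : Matrix ι ι R) (T : Finset ι)
    {i k : ι} (h : i ≠ k) :
    adjEntry M T i k = -∑ l ∈ T.erase i, M i l * adjEntry M (T.erase i) l k := by
  rw [adjEntry, pathSum_eq, Pi.single_eq_of_ne h, zero_mul, zero_sub]
  rfl

/-- In a path sum the closing entry `v k` stands to the left of the determinant of the unvisited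
indices. Reality of that determinant lets `v k` move to the far right. -/
theorem pathSum_eq_sum_adjEntry {ι : Type*} [LinearOrder ι] {H : Matrix ι ι ℍ[ℝ]} (v : ι → ℍ[ℝ])
    {S : Finset ι} {i : ι} (hi : i ∉ S)
    (hreal : ∀ S' ⊆ S, star (principalDet H S') = principalDet H S') :
    pathSum H v S i = ∑ k ∈ insert i S, adjEntry H (insert i S) i k * v k := by
  induction hc : S.card using Nat.strong_induction_on generalizing S i with
  | _ c ih =>
  rw [pathSum_eq, Finset.sum_insert hi, adjEntry_self, Finset.erase_insert hi,
    mul_comm_of_star_eq (hreal S subset_rfl), sub_eq_add_neg]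
  congr 1
  have h1 : ∀ j ∈ S, pathSum H v (S.erase j) j = ∑ k ∈ S, adjEntry H S j k * v k := by
    intro j hj
    rw [ih _ (hc ▸ Finset.card_erase_lt_of_mem hj) (by simp)
      (fun S' hS' => hreal S' (hS'.trans (Finset.erase_subset _ _))) rfl, Finset.insert_erase hj]
  have h2 : ∀ k ∈ S, adjEntry H (insert i S) i k = -∑ l ∈ S, H i l * adjEntry H S l k := by
    intro k hk
    rw [adjEntry_of_ne _ _ (by rintro rfl; exact hi hk), Finset.erase_insert hi]
  have e1 : ∑ j ∈ S, H i j * pathSum H v (S.erase j) j =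
      ∑ j ∈ S, H i j * ∑ k ∈ S, adjEntry H S j k * v k :=
    Finset.sum_congr rfl fun j hj => by rw [h1 j hj]
  have e2 : ∑ k ∈ S, adjEntry H (insert i S) i k * v k =
      ∑ k ∈ S, (-∑ l ∈ S, H i l * adjEntry H S l k) * v k :=
    Finset.sum_congr rfl fun k hk => by rw [h2 k hk]
  rw [e1, e2]
  simp only [Finset.mul_sum, neg_mul, Finset.sum_mul, Finset.sum_neg_distrib, mul_assoc]
  rw [Finset.sum_comm]

/-- `adjEntry` is defined by its first step; a path may equally be split at its last one. The
remaining determinant sits at the end of the path and must be moved past `H j k`, which needs it to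
be real. -/
theorem adjEntry_last_step {ι : Type*} [LinearOrder ι] {H : Matrix ι ι ℍ[ℝ]}
    {T : Finset ι} (hreal : ∀ S' ⊂ T, star (principalDet H S') = principalDet H S')
    {i k : ι} (hi : i ∈ T) (hk : k ∈ T) (hik : i ≠ k) :
    adjEntry H T i k = -∑ j ∈ T.erase k, adjEntry H (T.erase k) i j * H j k := by
  induction hc : T.card using Nat.strong_induction_on generalizing T i with
  | _ c ih =>
  have hki : k ∈ T.erase i := by simp [hk, hik.symm]
  have hik' : i ∈ T.erase k := by simp [hi, hik]
  have hsub : T.erase i ⊂ T := Finset.erase_ssubset hi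
  have hcomm : (T.erase k).erase i = (T.erase i).erase k := Finset.erase_right_comm
  rw [adjEntry_of_ne _ _ hik, ← Finset.add_sum_erase _ _ hki, ← Finset.add_sum_erase _ _ hik',
    adjEntry_self, adjEntry_self, hcomm]
  congr 2
  · rw [mul_comm_of_star_eq (hreal _ ((Finset.erase_subset _ _).trans_ssubset hsub))]
  · have h1 : ∀ l ∈ (T.erase i).erase k, adjEntry H (T.erase i) l k =
        -∑ j ∈ (T.erase i).erase k, adjEntry H ((T.erase i).erase k) l j * H j k := by
      intro l hl
      simp only [Finset.mem_erase] at hl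
      exact ih _ (hc ▸ Finset.card_erase_lt_of_mem hi) (fun S' hS' => hreal S' (hS'.trans hsub))
        (by simp [hl]) hki hl.1 rfl
    have h2 : ∀ j ∈ (T.erase i).erase k, adjEntry H (T.erase k) i j =
        -∑ l ∈ (T.erase i).erase k, H i l * adjEntry H ((T.erase i).erase k) l j := by
      intro j hj
      simp only [Finset.mem_erase] at hj
      rw [adjEntry_of_ne _ _ (Ne.symm hj.2.1), hcomm]
    have e1 : ∑ l ∈ (T.erase i).erase k, H i l * adjEntry H (T.erase i) l k =
        ∑ l ∈ (T.erase i).erase k, H i l *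
          -∑ j ∈ (T.erase i).erase k, adjEntry H ((T.erase i).erase k) l j * H j k :=
      Finset.sum_congr rfl fun l hl => by rw [h1 l hl]
    have e2 : ∑ j ∈ (T.erase i).erase k, adjEntry H (T.erase k) i j * H j k =
        ∑ j ∈ (T.erase i).erase k,
          (-∑ l ∈ (T.erase i).erase k, H i l * adjEntry H ((T.erase i).erase k) l j) * H j k :=
      Finset.sum_congr rfl fun j hj => by rw [h2 j hj]
    rw [e1, e2]
    simp only [Finset.mul_sum, neg_mul, mul_neg, Finset.sum_mul, Finset.sum_neg_distrib, mul_assoc]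
    rw [Finset.sum_comm]

/-- Conjugation reverses paths: it turns the first-step recursion into the last-step recursion. -/
theorem star_adjEntry {ι : Type*} [LinearOrder ι] {H : Matrix ι ι ℍ[ℝ]} (hH : H.IsHermitian)
    {T : Finset ι} (hreal : ∀ S' ⊂ T, star (principalDet H S') = principalDet H S')
    {i k : ι} (hi : i ∈ T) (hk : k ∈ T) : star (adjEntry H T i k) = adjEntry H T k i := by
  induction hc : T.card using Nat.strong_induction_on generalizing T i k with
  | _ c ih =>
  by_cases hik : i = k
  · subst hik
    rw [adjEntry_self, hreal _ (Finset.erase_ssubset hi)]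
  · rw [adjEntry_of_ne _ _ hik, adjEntry_last_step hreal hk hi (Ne.symm hik), star_neg, star_sum]
    congr 1
    refine Finset.sum_congr rfl fun l hl => ?_
    rw [star_mul, ih _ (hc ▸ Finset.card_erase_lt_of_mem hi)
      (fun S' hS' => hreal S' (hS'.trans (Finset.erase_ssubset hi))) hl
      (by simp [hk, Ne.symm hik]) rfl, hH.apply]

/-- A matrix whose last column repeats one of the columns of a Hermitian matrix has vanishing
expansion along the first cycle. -/
theorem pathSum_column_eq_zero {ι : Type*} [LinearOrder ι] {H : Matrix ι ι ℍ[ℝ]} {S : Finset ι}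
    (hexp : ∀ S' ⊆ S, ∀ a ∈ S',
      pathSum H (fun k => H k a) (S'.erase a) a = principalDet H S')
    (i : ι) {j : ι} (hj : j ∈ S) : pathSum H (fun k => H k j) S i = 0 := by
  induction hc : S.card using Nat.strong_induction_on generalizing S i with
  | _ c ih =>
  -- Closing at once and stepping to `j` give the same term with opposite signs, since the expansion
  -- that starts and closes at `j` is the determinant on `S`; steps elsewhere vanish by induction.
  rw [pathSum_eq, ← Finset.add_sum_erase _ _ hj, hexp S subset_rfl j hj, Finset.sum_eq_zero]
  · simp
  · intro l hl
    rw [Finset.mem_erase] at hl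
    rw [ih _ (hc ▸ Finset.card_erase_lt_of_mem hl.2)
      (fun S' hS' => hexp S' (hS'.trans (Finset.erase_subset _ _))) l
      (by simp [hj, Ne.symm hl.1]) rfl, mul_zero]

theorem continuous_pathSum_principalDet {R ι X : Type*} [Ring R] [TopologicalSpace R]
    [IsTopologicalRing R] [LinearOrder ι] [TopologicalSpace X] {M : X → Matrix ι ι R}
    (hM : ∀ i j, Continuous fun x => M x i j) (k : ℕ) : ∀ S : Finset ι, S.card = k →
      (Continuous fun x => principalDet (M x) S) ∧
      (∀ (v : X → ι → R) (i : ι), (∀ j, Continuous fun x => v x j) →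
        Continuous fun x => pathSum (M x) (v x) S i) := by
  induction k using Nat.strong_induction_on with
  | _ k ih =>
  intro S hS
  have h1 : Continuous fun x => principalDet (M x) S := by
    by_cases h : S.Nonempty
    · simp only [principalDet_of_nonempty _ h]
      exact (ih _ (hS ▸ Finset.card_erase_lt_of_mem (S.max'_mem h)) _ rfl).2 _ _ fun j => hM _ _
    · simp only [principalDet, dif_neg h]
      exact continuous_const
  refine ⟨h1, fun v i hv => ?_⟩
  simp only [pathSum_eq _ _ S]
  exact ((hv i).mul h1).sub (continuous_finsetSum _ fun j hj => (hM i j).mul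
    ((ih _ (hS ▸ Finset.card_erase_lt_of_mem hj) _ rfl).2 v j hv))

/-- The expansion at `a` is `h_aa` times a real determinant minus `∑ h_aj K_jk h_ka`, where `K` is
the Hermitian adjugate on `T.erase a`. Both terms are self-adjoint. -/
theorem star_pathSum_column {ι : Type*} [LinearOrder ι] {H : Matrix ι ι ℍ[ℝ]}
    (hH : H.IsHermitian) {T : Finset ι}
    (hreal : ∀ S' ⊂ T, star (principalDet H S') = principalDet H S') {a : ι} (ha : a ∈ T) :
    star (pathSum H (fun k => H k a) (T.erase a) a) =
      pathSum H (fun k => H k a) (T.erase a) a := by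
  have hsub := Finset.erase_ssubset ha
  have h1 : ∀ j ∈ T.erase a, pathSum H (fun k => H k a) ((T.erase a).erase j) j =
      ∑ k ∈ T.erase a, adjEntry H (T.erase a) j k * H k a := by
    intro j hj
    rw [pathSum_eq_sum_adjEntry _ (by simp), Finset.insert_erase hj]
    exact fun S' hS' => hreal S' ((hS'.trans (Finset.erase_subset _ _)).trans_ssubset hsub)
  rw [pathSum_eq, Finset.sum_congr rfl fun j hj => by rw [h1 j hj], star_sub, star_mul,
    hreal _ hsub, hH.apply, mul_comm_of_star_eq (hreal _ hsub), star_sum]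
  congr 1
  simp only [Finset.mul_sum, star_sum]
  rw [Finset.sum_comm]
  refine Finset.sum_congr rfl fun k hk => Finset.sum_congr rfl fun j hj => ?_
  rw [star_mul, star_mul, hH.apply, hH.apply,
    star_adjEntry hH (fun S' hS' => hreal S' (hS'.trans hsub)) hj hk, mul_assoc]

/-- Associativity of `H K H` at the entry `(a, b)`. The diagonal form of `H K` is the adjoint of
that of `K H`. -/
theorem pathSum_column_comm {ι : Type*} [LinearOrder ι] {H : Matrix ι ι ℍ[ℝ]}
    (hH : H.IsHermitian) {T : Finset ι}
    (hreal : ∀ S' ⊂ T, star (principalDet H S') = principalDet H S')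
    (hexp : ∀ S' ⊂ T, ∀ a ∈ S',
      pathSum H (fun k => H k a) (S'.erase a) a = principalDet H S')
    {a b : ι} (ha : a ∈ T) (hb : b ∈ T) :
    pathSum H (fun k => H k a) (T.erase a) a * H a b =
      H a b * pathSum H (fun k => H k b) (T.erase b) b := by
  have hKH : ∀ x ∈ T, ∀ y ∈ T, ∑ k ∈ T, adjEntry H T x k * H k y =
      if x = y then pathSum H (fun k => H k x) (T.erase x) x else 0 := by
    intro x hx y hy
    have hsub := Finset.erase_ssubset hx
    have := pathSum_eq_sum_adjEntry (fun k => H k y) (Finset.notMem_erase x T)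
      (fun S' hS' => hreal S' (hS'.trans_ssubset hsub))
    rw [Finset.insert_erase hx] at this
    rw [← this]
    split_ifs with hxy
    · rw [hxy]
    · exact pathSum_column_eq_zero (fun S' hS' => hexp S' (hS'.trans_ssubset hsub)) x
        (by simp [hy, Ne.symm hxy])
  have hHK : ∀ x ∈ T, ∀ y ∈ T, ∑ k ∈ T, H x k * adjEntry H T k y =
      if x = y then pathSum H (fun k => H k x) (T.erase x) x else 0 := by
    intro x hx y hy
    have := congrArg star (hKH y hy x hx)
    rw [star_sum] at this
    rw [Finset.sum_congr rfl fun k hk => by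
      rw [← star_adjEntry hH hreal hy hk, ← hH.apply x k, ← star_mul], this]
    by_cases hxy : x = y
    · subst hxy
      simp [star_pathSum_column hH hreal hx]
    · simp [hxy, Ne.symm hxy]
  calc _ = ∑ l ∈ T, (∑ k ∈ T, H a k * adjEntry H T k l) * H l b := by
        rw [Finset.sum_congr rfl fun l hl => by rw [hHK a ha l hl]]
        simp [ite_mul, ha]
    _ = ∑ k ∈ T, H a k * ∑ l ∈ T, adjEntry H T k l * H l b := by
        simp only [Finset.sum_mul, Finset.mul_sum, mul_assoc]
        rw [Finset.sum_comm]
    _ = _ := by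
        rw [Finset.sum_congr rfl fun l hl => by rw [hKH l hl b hb]]
        simp [mul_ite, hb]

/-- The expansions are real, so `h_ab ≠ 0` can be cancelled from `pathSum_column_comm`. In general a
real `ε` is added to the entries `(a, b)` and `(b, a)`; the identity holds for all `ε` but at most
one, hence at `ε = 0` by continuity. -/
theorem pathSum_column_eq {ι : Type*} [LinearOrder ι] {T : Finset ι}
    (hreal : ∀ H : Matrix ι ι ℍ[ℝ], H.IsHermitian →
      ∀ S' ⊂ T, star (principalDet H S') = principalDet H S')
    (hexp : ∀ H : Matrix ι ι ℍ[ℝ], H.IsHermitian → ∀ S' ⊂ T, ∀ a ∈ S',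
      pathSum H (fun k => H k a) (S'.erase a) a = principalDet H S')
    {H : Matrix ι ι ℍ[ℝ]} (hH : H.IsHermitian) {a b : ι} (ha : a ∈ T) (hb : b ∈ T) :
    pathSum H (fun k => H k a) (T.erase a) a = pathSum H (fun k => H k b) (T.erase b) b := by
  by_cases hab : a = b
  · rw [hab]
  set P : ℝ → Matrix ι ι ℍ[ℝ] := fun ε => H + Matrix.of fun i j =>
    if (i = a ∧ j = b) ∨ (i = b ∧ j = a) then (ε : ℍ[ℝ]) else 0 with hP
  have hPH : ∀ ε, (P ε).IsHermitian := by
    intro ε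
    refine hH.add (Matrix.IsHermitian.ext fun i j => ?_)
    simp only [Matrix.of_apply]
    by_cases h : (i = a ∧ j = b) ∨ (i = b ∧ j = a)
    · rw [if_pos h, if_pos (by tauto), Quaternion.star_coe]
    · rw [if_neg h, if_neg (by tauto), star_zero]
  have hPab : ∀ ε, P ε a b = H a b + (ε : ℍ[ℝ]) := by
    intro ε
    simp [hP]
  have hPc : ∀ i j, Continuous fun ε => P ε i j := by
    intro i j
    simp only [hP, Matrix.add_apply, Matrix.of_apply]
    refine continuous_const.add ?_
    split_ifs
    · exact Quaternion.continuous_coe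
    · exact continuous_const
  have hne : ∀ ε : ℝ, ε ≠ -(H a b).re →
      pathSum (P ε) (fun k => P ε k a) (T.erase a) a =
        pathSum (P ε) (fun k => P ε k b) (T.erase b) b := by
    intro ε hε
    have h0 : P ε a b ≠ 0 := by
      intro h
      rw [hPab] at h
      have := congrArg (fun q : ℍ[ℝ] => q.re) h
      simp at this
      exact hε (by linarith)
    have h1 := pathSum_column_comm (hPH ε) (hreal _ (hPH ε)) (hexp _ (hPH ε)) ha hb
    rw [← mul_comm_of_star_eq (star_pathSum_column (hPH ε) (hreal _ (hPH ε)) hb)] at h1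
    exact mul_right_cancel₀ h0 h1
  have hfun := Continuous.ext_on (dense_compl_singleton (-(H a b).re))
    ((continuous_pathSum_principalDet hPc _ (T.erase a) rfl).2
      (fun ε k => P ε k a) a fun j => hPc _ _)
    ((continuous_pathSum_principalDet hPc _ (T.erase b) rfl).2
      (fun ε k => P ε k b) b fun j => hPc _ _) (fun ε hε => hne ε hε)
  have h0 : P 0 = H := by
    refine Matrix.ext fun i j => ?_
    simp [hP]
  have := congrFun hfun 0
  simpa only [h0] using this

/-- The induction quantifies over all Hermitian `H`, because the perturbation argument needs the
hypothesis for the perturbed matrices too. -/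
theorem principalDet_hermitian {ι : Type*} [LinearOrder ι] (k : ℕ) : ∀ (T : Finset ι),
    T.card = k → ∀ H : Matrix ι ι ℍ[ℝ], H.IsHermitian →
      star (principalDet H T) = principalDet H T ∧
      ∀ a ∈ T, pathSum H (fun k => H k a) (T.erase a) a = principalDet H T := by
  induction k using Nat.strong_induction_on with
  | _ k ih =>
  intro T hT H hH
  have hreal : ∀ H : Matrix ι ι ℍ[ℝ], H.IsHermitian →
      ∀ S' ⊂ T, star (principalDet H S') = principalDet H S' := fun H hH S' hS' =>
    (ih _ (hT ▸ Finset.card_lt_card hS') S' rfl H hH).1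
  have hexp : ∀ H : Matrix ι ι ℍ[ℝ], H.IsHermitian → ∀ S' ⊂ T, ∀ a ∈ S',
      pathSum H (fun k => H k a) (S'.erase a) a = principalDet H S' := fun H hH S' hS' =>
    (ih _ (hT ▸ Finset.card_lt_card hS') S' rfl H hH).2
  by_cases h : T.Nonempty
  · rw [principalDet_of_nonempty _ h]
    exact ⟨star_pathSum_column hH (hreal H hH) (T.max'_mem h),
      fun a ha => pathSum_column_eq hreal hexp hH ha (T.max'_mem h)⟩
  · rw [Finset.not_nonempty_iff_eq_empty] at h
    subst h
    simp [principalDet_empty]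

/-- The Chen determinant of a Hermitian quaternionic matrix is real. -/
theorem star_principalDet {ι : Type*} [LinearOrder ι] {H : Matrix ι ι ℍ[ℝ]} (hH : H.IsHermitian)
    (T : Finset ι) : star (principalDet H T) = principalDet H T :=
  (principalDet_hermitian _ T rfl H hH).1

/-- The Chen determinant of a Hermitian quaternionic matrix may be expanded along the cycle
through any index. -/
theorem pathSum_column_self {ι : Type*} [LinearOrder ι] {H : Matrix ι ι ℍ[ℝ]}
    (hH : H.IsHermitian) {T : Finset ι} {a : ι} (ha : a ∈ T) :
    pathSum H (fun k => H k a) (T.erase a) a = principalDet H T :=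
  (principalDet_hermitian _ T rfl H hH).2 a ha

end Hermitian

/-! ### Cramer's rule and Chen's inverse formula -/

section Cramer

/-- A path sum over `S` reads only columns in `S` and the closing vector. Replacing the last column
of a matrix therefore changes only the closing vector of its expansion. -/
theorem pathSum_principalDet_congr {R ι : Type*} [Ring R] [LinearOrder ι] {M N : Matrix ι ι R}
    (k : ℕ) : ∀ S : Finset ι, S.card = k →
      ((∀ a ∈ S, ∀ b ∈ S, M a b = N a b) → principalDet M S = principalDet N S) ∧
      (∀ (v w : ι → R) (i : ι), (∀ a ∈ insert i S, ∀ b ∈ S, M a b = N a b) →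
        (∀ a ∈ insert i S, v a = w a) → pathSum M v S i = pathSum N w S i) := by
  induction k using Nat.strong_induction_on with
  | _ k ih =>
  intro S hS
  have h1 : (∀ a ∈ S, ∀ b ∈ S, M a b = N a b) → principalDet M S = principalDet N S := by
    intro hMN
    by_cases h : S.Nonempty
    · have hm := S.max'_mem h
      rw [principalDet_of_nonempty _ h, principalDet_of_nonempty _ h]
      refine (ih _ (hS ▸ Finset.card_erase_lt_of_mem hm) _ rfl).2 _ _ _ ?_ ?_
      · rw [Finset.insert_erase hm]
        exact fun a ha b hb => hMN a ha b (Finset.mem_of_mem_erase hb)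
      · rw [Finset.insert_erase hm]
        exact fun a ha => hMN a ha _ hm
    · simp only [principalDet, dif_neg h]
  refine ⟨h1, fun v w i hMN hvw => ?_⟩
  rw [pathSum_eq, pathSum_eq N, h1 fun a ha => hMN a (by simp [ha]), hvw i (by simp)]
  congr 1
  refine Finset.sum_congr rfl fun j hj => ?_
  rw [hMN i (by simp) j hj,
    (ih _ (hS ▸ Finset.card_erase_lt_of_mem hj) (S.erase j) rfl).2 v w j]
  · rw [Finset.insert_erase hj]
    exact fun a ha b hb => hMN a (by simp [ha]) b (Finset.mem_of_mem_erase hb)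
  · rw [Finset.insert_erase hj]
    exact fun a ha => hvw a (by simp [ha])

theorem sum_adjEntry_mul {ι : Type*} [LinearOrder ι] {H : Matrix ι ι ℍ[ℝ]} (hH : H.IsHermitian)
    {T : Finset ι} {a b : ι} (ha : a ∈ T) (hb : b ∈ T) :
    ∑ k ∈ T, adjEntry H T a k * H k b = if a = b then principalDet H T else 0 := by
  have h := pathSum_eq_sum_adjEntry (fun k => H k b) (Finset.notMem_erase a T)
    (fun S' _ => star_principalDet hH S')
  rw [Finset.insert_erase ha] at h
  rw [← h]
  split_ifs with hab
  · rw [← hab, pathSum_column_self hH ha]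
  · exact pathSum_column_eq_zero (fun S' _ a ha => pathSum_column_self hH ha) a
      (by simp [hb, Ne.symm hab])

theorem pathSum_mulVec {ι : Type*} [LinearOrder ι] [Fintype ι] {H : Matrix ι ι ℍ[ℝ]}
    (hH : H.IsHermitian) (y : ι → ℍ[ℝ]) (a : ι) :
    pathSum H (H *ᵥ y) (Finset.univ.erase a) a = principalDet H Finset.univ * y a := by
  rw [pathSum_eq_sum_adjEntry _ (Finset.notMem_erase a _) (fun S' _ => star_principalDet hH S'),
    Finset.insert_erase (Finset.mem_univ a)]
  simp only [Matrix.mulVec, dotProduct, Finset.mul_sum]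
  rw [Finset.sum_comm]
  simp only [← mul_assoc, ← Finset.sum_mul]
  rw [Finset.sum_congr rfl fun b hb => by rw [sum_adjEntry_mul hH (Finset.mem_univ a) hb]]
  simp [ite_mul]

theorem principalDet_univ_eq {R : Type*} [Ring R] {m : ℕ}
    (M : Matrix (Fin (m + 1)) (Fin (m + 1)) R) :
    principalDet M Finset.univ =
      pathSum M (fun k => M k (Fin.last m)) (Finset.univ.erase (Fin.last m)) (Fin.last m) := by
  have h : (Finset.univ : Finset (Fin (m + 1))).max' Finset.univ_nonempty = Fin.last m :=
    le_antisymm (Fin.le_last _) (Finset.le_max' _ _ (Finset.mem_univ _))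
  rw [principalDet_of_nonempty M Finset.univ_nonempty, h]

/-- Cramer's rule for Hermitian quaternionic matrices. -/
theorem cdet_updateCol_mulVec {m : ℕ} {H : Matrix (Fin (m + 1)) (Fin (m + 1)) ℍ[ℝ]}
    (hH : H.IsHermitian) (y : Fin (m + 1) → ℍ[ℝ]) :
    cdet (H.updateCol (Fin.last m) (H *ᵥ y)) = cdet H * y (Fin.last m) := by
  rw [cdet_eq_principalDet, cdet_eq_principalDet, ← pathSum_mulVec hH, principalDet_univ_eq]
  refine (pathSum_principalDet_congr _ _ rfl).2 _ _ _ (fun a _ b hb => ?_) fun a _ => ?_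
  · exact Matrix.updateCol_ne (Finset.ne_of_mem_erase hb)
  · exact Matrix.updateCol_self

/-- Relabelling need not preserve the maximum of `S`, so the relabelled expansion may open at the
wrong index; for Hermitian `H` every index is allowed. -/
theorem pathSum_principalDet_submatrix {ι : Type*} [LinearOrder ι]
    {H : Matrix ι ι ℍ[ℝ]} (hH : H.IsHermitian) (e : Equiv.Perm ι) (k : ℕ) :
    ∀ S : Finset ι, S.card = k →
      principalDet (H.submatrix e e) S = principalDet H (S.map e.toEmbedding) ∧
      ∀ (v : ι → ℍ[ℝ]) (i : ι), pathSum (H.submatrix e e) (fun k => v (e k)) S i =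
        pathSum H v (S.map e.toEmbedding) (e i) := by
  induction k using Nat.strong_induction_on with
  | _ k ih =>
  intro S hS
  have h1 : principalDet (H.submatrix e e) S = principalDet H (S.map e.toEmbedding) := by
    by_cases h : S.Nonempty
    · have hm := S.max'_mem h
      rw [principalDet_of_nonempty _ h]
      have := (ih _ (hS ▸ Finset.card_erase_lt_of_mem hm) _ rfl).2
        (fun k => H k (e (S.max' h))) (S.max' h)
      rw [Finset.map_erase] at this
      exact this.trans (pathSum_column_self hH (Finset.mem_map_of_mem _ hm))
    · rw [Finset.not_nonempty_iff_eq_empty] at h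
      simp [h, principalDet_empty]
  refine ⟨h1, fun v i => ?_⟩
  rw [pathSum_eq, pathSum_eq H, h1, Finset.sum_map]
  congr 1
  refine Finset.sum_congr rfl fun j hj => ?_
  rw [(ih _ (hS ▸ Finset.card_erase_lt_of_mem hj) _ rfl).2, Finset.map_erase]
  rfl

/-- The Chen determinant of a Hermitian quaternionic matrix is invariant under simultaneous
permutations of its rows and columns. -/
theorem cdet_submatrix {n : ℕ} {H : Matrix (Fin n) (Fin n) ℍ[ℝ]} (hH : H.IsHermitian)
    (e : Equiv.Perm (Fin n)) : cdet (H.submatrix e e) = cdet H := by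
  rw [cdet_eq_principalDet, cdet_eq_principalDet,
    (pathSum_principalDet_submatrix hH e _ _ rfl).1, Finset.map_univ_equiv]

theorem star_cdet {n : ℕ} {H : Matrix (Fin n) (Fin n) ℍ[ℝ]} (hH : H.IsHermitian) :
    star (cdet H) = cdet H := by
  rw [cdet_eq_principalDet, star_principalDet hH]

theorem isUnit_of_cdet_ne_zero {n : ℕ} {H : Matrix (Fin n) (Fin n) ℍ[ℝ]} (hH : H.IsHermitian)
    (h : cdet H ≠ 0) : IsUnit H := by
  refine IsUnit.of_mul_eq_one_right
    (Matrix.of fun i k => (cdet H)⁻¹ * adjEntry H Finset.univ i k) ?_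
  refine Matrix.ext fun i j => ?_
  simp only [Matrix.mul_apply, Matrix.of_apply, mul_assoc, ← Finset.mul_sum]
  rw [sum_adjEntry_mul hH (Finset.mem_univ i) (Finset.mem_univ j), ← cdet_eq_principalDet,
    Matrix.one_apply]
  split_ifs
  · exact inv_mul_cancel₀ h
  · exact mul_zero _

theorem isUnit_of_cdet_conjTranspose_mul_ne_zero {n : ℕ} {W : Matrix (Fin n) (Fin n) ℍ[ℝ]}
    (h : cdet (Wᴴ * W) ≠ 0) : IsUnit W := by
  obtain ⟨u, hu⟩ := isUnit_of_cdet_ne_zero (Matrix.isHermitian_conjTranspose_mul_self W) h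
  refine IsUnit.of_mul_eq_one_right
    (((u⁻¹ : (Matrix (Fin n) (Fin n) ℍ[ℝ])ˣ) : Matrix (Fin n) (Fin n) ℍ[ℝ]) * Wᴴ) ?_
  rw [mul_assoc, ← hu, Units.inv_mul]

theorem replaceLast_eq_updateCol {R : Type*} [Ring R] {m : ℕ}
    (M : Matrix (Fin (m + 1)) (Fin (m + 1)) R) (i j : Fin (m + 1)) :
    replaceLast M i j = (swapLast M i).updateCol (Fin.last m) (Pi.single j 1) := by
  refine Matrix.ext fun a b => ?_
  rw [replaceLast]
  by_cases hb : b = Fin.last m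
  · subst hb
    rw [Matrix.updateCol_self, Matrix.updateCol_self]
  · rw [Matrix.updateCol_ne hb, Matrix.updateCol_ne hb]
    by_cases hbi : b = i
    · subst hbi
      simp [swapLast]
    · rw [Matrix.updateCol_ne hbi]
      simp [swapLast, Equiv.swap_apply_of_ne_of_ne hbi hb]

/-- Chen's formula for the last column of the inverse of a quaternionic matrix. -/
theorem cdet_swapLast_mul_replaceLast {m : ℕ} {W V : Matrix (Fin (m + 1)) (Fin (m + 1)) ℍ[ℝ]}
    (hWV : W * V = 1) (i : Fin (m + 1)) :
    cdet ((swapLast W i)ᴴ * replaceLast W i (Fin.last m)) =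
      cdet (Wᴴ * W) * V i (Fin.last m) := by
  set A := swapLast W i with hA
  set e := Equiv.swap i (Fin.last m) with he
  have hH : (Aᴴ * A).IsHermitian := Matrix.isHermitian_conjTranspose_mul_self A
  have hdet : cdet (Aᴴ * A) = cdet (Wᴴ * W) := by
    rw [← cdet_submatrix (Matrix.isHermitian_conjTranspose_mul_self W) e]
    rfl
  -- `A` is `W` with columns permuted by `e`, so the last column of `V`, permuted likewise, solves
  -- `A y = e_n`. Hence `A†e_n = (A†A) y`, and Cramer's rule reads off the last entry of `y`, namely
  -- `V i n`.
  have hAy : A *ᵥ (fun b => V (e b) (Fin.last m)) = Pi.single (Fin.last m) 1 := by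
    funext a
    have h := congrFun (congrFun hWV a) (Fin.last m)
    rw [Matrix.mul_apply, Matrix.one_apply] at h
    rw [Matrix.mulVec, dotProduct, Pi.single_apply, ← h]
    exact Equiv.sum_comp e fun b => W a b * V b (Fin.last m)
  have hmul : Aᴴ * replaceLast W i (Fin.last m) =
      (Aᴴ * A).updateCol (Fin.last m) ((Aᴴ * A) *ᵥ fun b => V (e b) (Fin.last m)) := by
    rw [replaceLast_eq_updateCol, ← Matrix.mulVec_mulVec, hAy]
    refine Matrix.ext fun a b => ?_
    by_cases hb : b = Fin.last m
    · subst hb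
      rw [Matrix.updateCol_self, Matrix.mul_apply]
      simp only [Matrix.updateCol_self]
      rfl
    · rw [Matrix.updateCol_ne hb, Matrix.mul_apply, Matrix.mul_apply]
      simp only [Matrix.updateCol_ne hb, hA]
  rw [hmul, cdet_updateCol_mulVec hH, hdet, he, Equiv.swap_apply_right]

theorem continuous_cdet {X : Type*} [TopologicalSpace X] {n : ℕ}
    {M : X → Matrix (Fin n) (Fin n) ℍ[ℝ]} (hM : ∀ i j, Continuous fun x => M x i j) :
    Continuous fun x => cdet (M x) := by
  simp only [cdet_eq_principalDet]
  exact (continuous_pathSum_principalDet hM _ _ rfl).1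

theorem cdet_fin_one {R : Type*} [Ring R] (M : Matrix (Fin 1) (Fin 1) R) : cdet M = M 0 0 := by
  have h : (Finset.univ : Finset (Fin 1)).erase (Fin.last 0) = ∅ := rfl
  rw [cdet_eq_principalDet, principalDet_univ_eq, h, pathSum_eq, principalDet_empty]
  simp

end Cramer

/-! ### Calculus of directional derivatives on open sets -/

section DirectionalDerivative

/-- The derivative of `f` in the direction `w`. -/
noncomputable def dirDeriv {E F : Type*} [NormedAddCommGroup E] [NormedSpace ℝ E]
    [NormedAddCommGroup F] [NormedSpace ℝ F] (w : E) (f : E → F) (p : E) : F :=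
  fderiv ℝ f p w

theorem contDiffOn_dirDeriv {E F : Type*} [NormedAddCommGroup E] [NormedSpace ℝ E]
    [NormedAddCommGroup F] [NormedSpace ℝ F] {U : Set E} (hU : IsOpen U) {f : E → F}
    (hf : ContDiffOn ℝ ∞ f U) (w : E) : ContDiffOn ℝ ∞ (dirDeriv w f) U :=
  (hf.fderiv_of_isOpen hU (by simp)).clm_apply contDiffOn_const

theorem contDiffOn_iterate_dirDeriv {E F : Type*} [NormedAddCommGroup E] [NormedSpace ℝ E]
    [NormedAddCommGroup F] [NormedSpace ℝ F] {U : Set E} (hU : IsOpen U) {f : E → F}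
    (hf : ContDiffOn ℝ ∞ f U) (w : E) (k : ℕ) : ContDiffOn ℝ ∞ ((dirDeriv w)^[k] f) U := by
  induction k with
  | zero => exact hf
  | succ k ih =>
    rw [Function.iterate_succ_apply']
    exact contDiffOn_dirDeriv hU ih w

theorem differentiableAt_of_contDiffOn {E F : Type*} [NormedAddCommGroup E] [NormedSpace ℝ E]
    [NormedAddCommGroup F] [NormedSpace ℝ F] {U : Set E} (hU : IsOpen U) {f : E → F}
    (hf : ContDiffOn ℝ ∞ f U) {p : E} (hp : p ∈ U) : DifferentiableAt ℝ f p :=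
  (hf.contDiffAt (hU.mem_nhds hp)).differentiableAt (by simp)

theorem dirDeriv_congr {E F : Type*} [NormedAddCommGroup E] [NormedSpace ℝ E]
    [NormedAddCommGroup F] [NormedSpace ℝ F] {U : Set E} (hU : IsOpen U) {f g : E → F}
    (h : Set.EqOn f g U) (w : E) : Set.EqOn (dirDeriv w f) (dirDeriv w g) U := by
  intro p hp
  rw [dirDeriv, dirDeriv, (h.eventuallyEq_of_mem (hU.mem_nhds hp)).fderiv_eq]

theorem iterate_dirDeriv_congr {E F : Type*} [NormedAddCommGroup E] [NormedSpace ℝ E]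
    [NormedAddCommGroup F] [NormedSpace ℝ F] {U : Set E} (hU : IsOpen U) {f g : E → F}
    (h : Set.EqOn f g U) (w : E) (k : ℕ) :
    Set.EqOn ((dirDeriv w)^[k] f) ((dirDeriv w)^[k] g) U := by
  induction k with
  | zero => exact h
  | succ k ih =>
    rw [Function.iterate_succ_apply', Function.iterate_succ_apply']
    exact dirDeriv_congr hU ih w

theorem dirDeriv_add {E F : Type*} [NormedAddCommGroup E] [NormedSpace ℝ E]
    [NormedAddCommGroup F] [NormedSpace ℝ F] {U : Set E} (hU : IsOpen U) {f g : E → F}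
    (hf : ContDiffOn ℝ ∞ f U) (hg : ContDiffOn ℝ ∞ g U) (w : E) {p : E} (hp : p ∈ U) :
    dirDeriv w (fun q => f q + g q) p = dirDeriv w f p + dirDeriv w g p := by
  rw [dirDeriv, fderiv_fun_add (differentiableAt_of_contDiffOn hU hf hp)
    (differentiableAt_of_contDiffOn hU hg hp)]
  rfl

theorem dirDeriv_mul {E A : Type*} [NormedAddCommGroup E] [NormedSpace ℝ E]
    [NormedRing A] [NormedAlgebra ℝ A] {U : Set E} (hU : IsOpen U) {f g : E → A}
    (hf : ContDiffOn ℝ ∞ f U) (hg : ContDiffOn ℝ ∞ g U) (w : E) {p : E} (hp : p ∈ U) :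
    dirDeriv w (fun q => f q * g q) p = dirDeriv w f p * g p + f p * dirDeriv w g p := by
  rw [dirDeriv, fderiv_fun_mul' (differentiableAt_of_contDiffOn hU hf hp)
    (differentiableAt_of_contDiffOn hU hg hp), add_comm]
  simp [dirDeriv]

theorem dirDeriv_const {E F : Type*} [NormedAddCommGroup E] [NormedSpace ℝ E]
    [NormedAddCommGroup F] [NormedSpace ℝ F] (c : F) (w p : E) :
    dirDeriv w (fun _ : E => c) p = 0 := by
  simp [dirDeriv]

theorem dirDeriv_mul_const {E A : Type*} [NormedAddCommGroup E] [NormedSpace ℝ E]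
    [NormedRing A] [NormedAlgebra ℝ A] {U : Set E} (hU : IsOpen U) {f : E → A}
    (hf : ContDiffOn ℝ ∞ f U) (c : A) (w : E) {p : E} (hp : p ∈ U) :
    dirDeriv w (fun q => f q * c) p = dirDeriv w f p * c := by
  rw [dirDeriv_mul hU hf contDiffOn_const w hp, dirDeriv_const, mul_zero, add_zero]

theorem dirDeriv_const_mul {E A : Type*} [NormedAddCommGroup E] [NormedSpace ℝ E]
    [NormedRing A] [NormedAlgebra ℝ A] {U : Set E} (hU : IsOpen U) {f : E → A}
    (hf : ContDiffOn ℝ ∞ f U) (c : A) (w : E) {p : E} (hp : p ∈ U) :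
    dirDeriv w (fun q => c * f q) p = c * dirDeriv w f p := by
  rw [dirDeriv_mul hU contDiffOn_const hf w hp, dirDeriv_const, zero_mul, zero_add]

theorem dirDeriv_clm {E F G : Type*} [NormedAddCommGroup E] [NormedSpace ℝ E]
    [NormedAddCommGroup F] [NormedSpace ℝ F] [NormedAddCommGroup G] [NormedSpace ℝ G]
    {U : Set E} (hU : IsOpen U) {f : E → F} (hf : ContDiffOn ℝ ∞ f U) (L : F →L[ℝ] G) (w : E)
    {p : E} (hp : p ∈ U) : dirDeriv w (fun q => L (f q)) p = L (dirDeriv w f p) := by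
  exact DFunLike.congr_fun (L.hasFDerivAt.comp p
    (differentiableAt_of_contDiffOn hU hf hp).hasFDerivAt).fderiv w

theorem dirDeriv_comm {E F : Type*} [NormedAddCommGroup E] [NormedSpace ℝ E]
    [NormedAddCommGroup F] [NormedSpace ℝ F] {U : Set E} (hU : IsOpen U) {f : E → F}
    (hf : ContDiffOn ℝ ∞ f U) (v w : E) {p : E} (hp : p ∈ U) :
    dirDeriv v (dirDeriv w f) p = dirDeriv w (dirDeriv v f) p := by
  have hd := differentiableAt_of_contDiffOn hU (hf.fderiv_of_isOpen (m := ∞) hU (by simp)) hp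
  have key : ∀ a b : E, dirDeriv a (dirDeriv b f) p = fderiv ℝ (fderiv ℝ f) p a b := by
    intro a b
    have : dirDeriv b f = fun q => fderiv ℝ f q b := rfl
    rw [dirDeriv, this, fderiv_clm_apply hd (differentiableAt_const b)]
    simp
  rw [key, key]
  refine ContDiffAt.isSymmSndFDerivAt (n := ∞) (hf.contDiffAt (hU.mem_nhds hp)) ?_ v w
  rw [minSmoothness_of_isRCLikeNormedField]
  exact WithTop.coe_le_coe.2 (le_top : (2 : ℕ∞) ≤ ⊤)

theorem iterate_dirDeriv_sum_mul_const {E A ι : Type*} [NormedAddCommGroup E] [NormedSpace ℝ E]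
    [NormedRing A] [NormedAlgebra ℝ A] {U : Set E} (hU : IsOpen U) (s : Finset ι)
    {f : ι → E → A} (hf : ∀ i, ContDiffOn ℝ ∞ (f i) U) (c : ι → A) (w : E) (k : ℕ) {p : E}
    (hp : p ∈ U) : (dirDeriv w)^[k] (fun q => ∑ i ∈ s, f i q * c i) p =
      ∑ i ∈ s, (dirDeriv w)^[k] (f i) p * c i := by
  induction k generalizing p with
  | zero => rfl
  | succ k ih =>
    simp only [Function.iterate_succ_apply']
    rw [dirDeriv_congr hU (fun q hq => ih hq) w hp, dirDeriv, fderiv_fun_sum fun i _ =>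
      (differentiableAt_of_contDiffOn hU (contDiffOn_iterate_dirDeriv hU (hf i) w k) hp).mul_const
        (c i), sum_apply]
    exact Finset.sum_congr rfl fun i _ => dirDeriv_mul_const hU
      (contDiffOn_iterate_dirDeriv hU (hf i) w k) (c i) w hp

end DirectionalDerivative

/-! ### The potential equation in a normed algebra -/

section PotentialKdV

/-- If `W` satisfies `W_xx = W Λ` and `W_t = W_xxx`, then its logarithmic derivative
`X = W_x W⁻¹` satisfies the potential form of the non-commutative KdV equation. -/
theorem potential_kdv_of_linear {E A : Type*} [NormedAddCommGroup E] [NormedSpace ℝ E]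
    [NormedRing A] [NormedAlgebra ℝ A] {U : Set E} (hU : IsOpen U) {W X : E → A} {Λ : A} {e τ : E}
    (hW : ContDiffOn ℝ ∞ W U) (hX : ContDiffOn ℝ ∞ X U) (hunit : ∀ p ∈ U, IsUnit (W p))
    (hXW : ∀ p ∈ U, X p * W p = dirDeriv e W p)
    (hclosure : ∀ p ∈ U, dirDeriv e (dirDeriv e W) p = W p * Λ)
    (hdisp : ∀ p ∈ U, dirDeriv τ W p = dirDeriv e (dirDeriv e (dirDeriv e W)) p)
    {p : E} (hp : p ∈ U) :
    4 * dirDeriv τ X p = dirDeriv e (dirDeriv e (dirDeriv e X)) p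
      + 6 * (dirDeriv e X p * dirDeriv e X p) := by
  have hX1 := contDiffOn_dirDeriv hU hX e
  have hW1 := contDiffOn_dirDeriv hU hW e
  set Q : E → A := fun q => dirDeriv e X q + X q * X q with hQ_def
  have hQ : ContDiffOn ℝ ∞ Q U := hX1.add (hX.mul hX)
  have hQW : ∀ q ∈ U, Q q * W q = W q * Λ := by
    intro q hq
    rw [← hclosure q hq, ← dirDeriv_congr hU hXW e hq, dirDeriv_mul hU hX hW e hq, ← hXW q hq,
      hQ_def]
    noncomm_ring
  -- Differentiating `QW = WΛ` and cancelling `W` gives `Q_x + QX = XQ`; expanding `Q` leaves this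
  -- identity.
  have hXX : ∀ q ∈ U, dirDeriv e (dirDeriv e X) q = -2 * (dirDeriv e X q * X q) := by
    intro q hq
    have h1 : dirDeriv e Q q * W q + Q q * (X q * W q) = X q * W q * Λ := by
      rw [hXW q hq, ← dirDeriv_mul hU hQ hW e hq, ← dirDeriv_mul_const hU hW Λ e hq]
      exact dirDeriv_congr hU hQW e hq
    have h2 : dirDeriv e Q q = dirDeriv e (dirDeriv e X) q
        + (dirDeriv e X q * X q + X q * dirDeriv e X q) := by
      rw [hQ_def, dirDeriv_add hU hX1 (hX.mul hX) e hq, dirDeriv_mul hU hX hX e hq]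
    have h3 : (dirDeriv e Q q + Q q * X q) * W q = X q * Q q * W q := by
      rw [mul_assoc (X q), hQW q hq, ← mul_assoc, ← h1]
      noncomm_ring
    have h4 := (hunit q hq).mul_right_cancel h3
    rw [h2, hQ_def] at h4
    rw [← sub_eq_zero] at h4 ⊢
    rw [← h4]
    noncomm_ring
  -- Since `W_t = W_x Λ = XWΛ` and `W_xt = WΛ²`, the `t`-derivative of `XW = W_x` gives `X_t W = (Q
  -- - X²)WΛ = X_x QW`.
  have hXt : dirDeriv τ X p = dirDeriv e X p * Q p := by
    have h3 : ∀ q ∈ U, dirDeriv e (dirDeriv e (dirDeriv e W)) q = dirDeriv e W q * Λ := by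
      intro q hq
      rw [← dirDeriv_mul_const hU hW Λ e hq]
      exact dirDeriv_congr hU hclosure e hq
    have h4 : dirDeriv τ (dirDeriv e W) p = W p * Λ * Λ := by
      rw [dirDeriv_comm hU hW τ e hp,
        dirDeriv_congr hU (fun q hq => (hdisp q hq).trans (h3 q hq)) e hp,
        dirDeriv_mul_const hU hW1 Λ e hp, hclosure p hp]
    have h5 : dirDeriv τ X p * W p + X p * (X p * W p * Λ) = W p * Λ * Λ := by
      rw [← h4, hXW p hp, ← h3 p hp, ← hdisp p hp, ← dirDeriv_mul hU hX hW τ hp]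
      exact dirDeriv_congr hU hXW τ hp
    refine (hunit p hp).mul_right_cancel ?_
    calc dirDeriv τ X p * W p = Q p * W p * Λ - X p * (X p * W p * Λ) := by
          rw [hQW p hp, eq_sub_of_add_eq h5]
      _ = dirDeriv e X p * (W p * Λ) := by rw [hQ_def]; noncomm_ring
      _ = dirDeriv e X p * Q p * W p := by rw [← hQW p hp, mul_assoc]
  have hXXX : dirDeriv e (dirDeriv e (dirDeriv e X)) p =
      4 * (dirDeriv e X p * X p * X p) - 2 * (dirDeriv e X p * dirDeriv e X p) := by
    rw [dirDeriv_congr hU hXX e hp, dirDeriv_const_mul hU (hX1.mul hX) (-2) e hp,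
      dirDeriv_mul hU hX1 hX e hp, hXX p hp]
    noncomm_ring
  rw [hXt, hXXX, hQ_def]
  noncomm_ring

end PotentialKdV

/-! ### Partial derivatives and the passage from the potential to KdV -/

section PartialDerivatives

theorem deriv_fst_eq_dirDeriv {F : Type*} [NormedAddCommGroup F] [NormedSpace ℝ F]
    {U : Set (ℝ × ℝ)} (hU : IsOpen U) {f g : ℝ × ℝ → F} (hg : ContDiffOn ℝ ∞ g U)
    (h : Set.EqOn f g U) {x t : ℝ} (hp : (x, t) ∈ U) :
    deriv (fun y => f (y, t)) x = dirDeriv (1, 0) g (x, t) := by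
  have h1 : HasDerivAt (fun y : ℝ => (y, t)) ((1 : ℝ), (0 : ℝ)) x :=
    (hasDerivAt_id x).prodMk (hasDerivAt_const x t)
  have h2 : (fun y => f (y, t)) =ᶠ[nhds x] fun y => g (y, t) :=
    Filter.mem_of_superset (h1.continuousAt.preimage_mem_nhds (hU.mem_nhds hp)) fun y hy => h hy
  rw [h2.deriv_eq]
  exact ((differentiableAt_of_contDiffOn hU hg hp).hasFDerivAt.comp_hasDerivAt x h1).deriv

theorem deriv_snd_eq_dirDeriv {F : Type*} [NormedAddCommGroup F] [NormedSpace ℝ F]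
    {U : Set (ℝ × ℝ)} (hU : IsOpen U) {f g : ℝ × ℝ → F} (hg : ContDiffOn ℝ ∞ g U)
    (h : Set.EqOn f g U) {x t : ℝ} (hp : (x, t) ∈ U) :
    deriv (fun s => f (x, s)) t = dirDeriv (0, 1) g (x, t) := by
  have h1 : HasDerivAt (fun s : ℝ => (x, s)) ((0 : ℝ), (1 : ℝ)) t :=
    (hasDerivAt_const t x).prodMk (hasDerivAt_id t)
  have h2 : (fun s => f (x, s)) =ᶠ[nhds t] fun s => g (x, s) :=
    Filter.mem_of_superset (h1.continuousAt.preimage_mem_nhds (hU.mem_nhds hp)) fun y hy => h hy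
  rw [h2.deriv_eq]
  exact ((differentiableAt_of_contDiffOn hU hg hp).hasFDerivAt.comp_hasDerivAt t h1).deriv

/-- Agreement on the open set `U` is enough, which matters for `chenExpression`, controlled only
where the determinant does not vanish. -/
theorem dx_eq_iterate_dirDeriv {U : Set (ℝ × ℝ)} (hU : IsOpen U) {f : ℝ → ℝ → ℍ[ℝ]}
    {g : ℝ × ℝ → ℍ[ℝ]} (hg : ContDiffOn ℝ ∞ g U) (h : ∀ p ∈ U, f p.1 p.2 = g p) (k : ℕ) :
    ∀ p ∈ U, dx k f p.1 p.2 = (dirDeriv (1, 0))^[k] g p := by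
  induction k with
  | zero =>
    intro p hp
    simpa [dx] using h p hp
  | succ k ih =>
    intro p hp
    rw [dx, iteratedDeriv_succ, Function.iterate_succ_apply']
    exact deriv_fst_eq_dirDeriv (f := fun p => dx k f p.1 p.2) hU
      (contDiffOn_iterate_dirDeriv hU hg _ k) ih hp

theorem dt_eq_dirDeriv {U : Set (ℝ × ℝ)} (hU : IsOpen U) {f : ℝ → ℝ → ℍ[ℝ]}
    {g : ℝ × ℝ → ℍ[ℝ]} (hg : ContDiffOn ℝ ∞ g U) (h : ∀ p ∈ U, f p.1 p.2 = g p) :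
    ∀ p ∈ U, dt f p.1 p.2 = dirDeriv (0, 1) g p := fun _ hp =>
  deriv_snd_eq_dirDeriv (f := fun p => f p.1 p.2) hU hg h hp

/-- The `x`-derivative of twice a solution of the potential equation solves the non-commutative
KdV equation. -/
theorem isKdVSolutionOn_of_potential {U : Set (ℝ × ℝ)} (hU : IsOpen U) {a : ℝ × ℝ → ℍ[ℝ]}
    (ha : ContDiffOn ℝ ∞ a U)
    (hpde : ∀ p ∈ U, 4 * dirDeriv (0, 1) a p =
      dirDeriv (1, 0) (dirDeriv (1, 0) (dirDeriv (1, 0) a)) p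
        + 6 * (dirDeriv (1, 0) a p * dirDeriv (1, 0) a p))
    {u : ℝ → ℝ → ℍ[ℝ]} (hu : ∀ p ∈ U, u p.1 p.2 = 2 * dirDeriv (1, 0) a p) :
    IsKdVSolutionOn u U := by
  have ha1 := contDiffOn_dirDeriv hU ha (1, 0)
  have ha2 := contDiffOn_dirDeriv hU ha1 (1, 0)
  have ha3 := contDiffOn_dirDeriv hU ha2 (1, 0)
  have hg : ContDiffOn ℝ ∞ (fun p => 2 * dirDeriv (1, 0) a p) U := contDiffOn_const.mul ha1
  refine ⟨hU, hg.congr hu, fun x t hp => ?_⟩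
  have e1 : ∀ k, Set.EqOn ((dirDeriv (1, 0))^[k] fun p => 2 * dirDeriv (1, 0) a p)
      (fun p => 2 * (dirDeriv (1, 0))^[k] (dirDeriv (1, 0) a) p) U := by
    intro k
    induction k with
    | zero => exact fun _ _ => rfl
    | succ k ih =>
      intro q hq
      rw [Function.iterate_succ_apply', Function.iterate_succ_apply', dirDeriv_congr hU ih _ hq,
        dirDeriv_const_mul hU (contDiffOn_iterate_dirDeriv hU ha1 _ k) 2 _ hq]
  have hdx : ∀ k, dx k u x t = 2 * (dirDeriv (1, 0))^[k] (dirDeriv (1, 0) a) (x, t) := fun k =>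
    (dx_eq_iterate_dirDeriv hU hg hu k _ hp).trans (e1 k hp)
  have hdt : dt u x t = 2 * dirDeriv (1, 0) (dirDeriv (0, 1) a) (x, t) := by
    rw [dirDeriv_comm hU ha _ _ hp, ← dirDeriv_const_mul hU ha1 2 _ hp]
    exact dt_eq_dirDeriv hU hg hu _ hp
  have key : 4 * dirDeriv (1, 0) (dirDeriv (0, 1) a) (x, t) =
      dirDeriv (1, 0) (dirDeriv (1, 0) (dirDeriv (1, 0) (dirDeriv (1, 0) a))) (x, t)
        + 6 * (dirDeriv (1, 0) (dirDeriv (1, 0) a) (x, t) * dirDeriv (1, 0) a (x, t)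
          + dirDeriv (1, 0) a (x, t) * dirDeriv (1, 0) (dirDeriv (1, 0) a) (x, t)) := by
    rw [← dirDeriv_const_mul hU (contDiffOn_dirDeriv hU ha (0, 1)) 4 _ hp,
      dirDeriv_congr hU hpde _ hp,
      dirDeriv_add hU ha3 (contDiffOn_const.mul (ha1.mul ha1)) _ hp,
      dirDeriv_const_mul hU (ha1.mul ha1) 6 _ hp, dirDeriv_mul hU ha1 ha1 _ hp]
  have hu0 : u x t = 2 * dirDeriv (1, 0) a (x, t) := hu _ hp
  rw [hdt, hdx 1, hdx 3, hu0]
  simp only [Function.iterate_succ_apply, Function.iterate_zero, id_eq]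
  set d1 := dirDeriv (1, 0) a (x, t)
  set d2 := dirDeriv (1, 0) (dirDeriv (1, 0) a) (x, t)
  set d4 := dirDeriv (1, 0) (dirDeriv (1, 0) (dirDeriv (1, 0) (dirDeriv (1, 0) a))) (x, t)
  set dxt := dirDeriv (1, 0) (dirDeriv (0, 1) a) (x, t)
  -- Multiplying by 4 clears the fractions, leaving integer coefficients for `noncomm_ring`.
  have h4 : (4 : ℝ) • (2 * dxt) = (4 : ℝ) • ((3 / 4 : ℝ) • (2 * d1 * (2 * d2)) +
      (3 / 4 : ℝ) • (2 * d2 * (2 * d1)) + (1 / 4 : ℝ) • (2 * d4)) := by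
    have r4 : ∀ z : ℍ[ℝ], (4 : ℝ) • z = 4 * z := fun z => by
      rw [Algebra.smul_def]; congr 1
    have r3 : ∀ z : ℍ[ℝ], (4 : ℝ) • (3 / 4 : ℝ) • z = 3 * z := fun z => by
      rw [smul_smul, show (4 * (3 / 4) : ℝ) = 3 by norm_num, Algebra.smul_def]; congr 1
    have r1 : ∀ z : ℍ[ℝ], (4 : ℝ) • (1 / 4 : ℝ) • z = z := fun z => by
      rw [smul_smul]; norm_num
    rw [smul_add, smul_add, r3, r3, r1, r4]
    have : 4 * (2 * dxt) = 2 * (4 * dxt) := by noncomm_ring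
    rw [this, key]
    noncomm_ring
  exact smul_right_injective _ (by norm_num : (4 : ℝ) ≠ 0) h4

end PartialDerivatives

/-! ### The Wronskian matrix and its logarithmic derivative -/

section Darboux

open scoped Matrix.Norms.Operator

/-- The entries of a matrix depend linearly and continuously on the matrix. -/
noncomputable def entryCLM (n : ℕ) (i j : Fin n) : Matrix (Fin n) (Fin n) ℍ[ℝ] →L[ℝ] ℍ[ℝ] :=
  LinearMap.toContinuousLinearMap (Matrix.entryLinearMap ℝ ℍ[ℝ] i j)

/-- The operator norm makes matrices a normed algebra, as the potential equation requires; in finite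
dimension the passage from entries is continuous for it. -/
theorem contDiffOn_matrix {E : Type*} [NormedAddCommGroup E] [NormedSpace ℝ E] {n : ℕ} {U : Set E}
    {M : E → Matrix (Fin n) (Fin n) ℍ[ℝ]} (hM : ∀ i j, ContDiffOn ℝ ∞ (fun p => M p i j) U) :
    ContDiffOn ℝ ∞ M U := by
  let L : (Fin n → Fin n → ℍ[ℝ]) →L[ℝ] Matrix (Fin n) (Fin n) ℍ[ℝ] :=
    LinearMap.toContinuousLinearMap (Matrix.ofLinearEquiv ℝ).toLinearMap
  exact L.contDiff.comp_contDiffOn (contDiffOn_pi.2 fun i => contDiffOn_pi.2 fun j => hM i j)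

theorem dirDeriv_apply {E : Type*} [NormedAddCommGroup E] [NormedSpace ℝ E] {n : ℕ} {U : Set E}
    (hU : IsOpen U) {M : E → Matrix (Fin n) (Fin n) ℍ[ℝ]} (hM : ContDiffOn ℝ ∞ M U) (w : E)
    (i j : Fin n) {p : E} (hp : p ∈ U) :
    dirDeriv w M p i j = dirDeriv w (fun q => M q i j) p :=
  (dirDeriv_clm hU hM (entryCLM n i j) w hp).symm

theorem contDiffOn_ringInverse {E : Type*} [NormedAddCommGroup E] [NormedSpace ℝ E] {n : ℕ}
    {U : Set E} {M : E → Matrix (Fin n) (Fin n) ℍ[ℝ]} (hM : ContDiffOn ℝ ∞ M U)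
    (hunit : ∀ p ∈ U, IsUnit (M p)) : ContDiffOn ℝ ∞ (fun p => Ring.inverse (M p)) U := by
  intro p hp
  obtain ⟨u, hu⟩ := hunit p hp
  have h := contDiffAt_ringInverse ℝ (n := ∞) u
  rw [hu] at h
  exact h.comp_contDiffWithinAt p (hM p hp)

theorem dx_kernel {n : ℕ} {Φ : Fin n → ℝ → ℝ → ℍ[ℝ]} (hΦ : IsKdVDarbouxKernel Φ) (k : ℕ)
    (i : Fin n) (p : ℝ × ℝ) :
    dx k (Φ i) p.1 p.2 = (dirDeriv (1, 0))^[k] (fun p : ℝ × ℝ => Φ i p.1 p.2) p :=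
  dx_eq_iterate_dirDeriv isOpen_univ (hΦ.smooth i).contDiffOn (fun _ _ => rfl) k p trivial

theorem contDiff_dx_kernel {n : ℕ} {Φ : Fin n → ℝ → ℝ → ℍ[ℝ]} (hΦ : IsKdVDarbouxKernel Φ) (k : ℕ)
    (i : Fin n) : ContDiff ℝ ∞ fun p : ℝ × ℝ => dx k (Φ i) p.1 p.2 := by
  simp only [dx_kernel hΦ]
  exact contDiffOn_univ.1
    (contDiffOn_iterate_dirDeriv isOpen_univ (hΦ.smooth i).contDiffOn (1, 0) k)

theorem dirDeriv_dx_kernel {n : ℕ} {Φ : Fin n → ℝ → ℝ → ℍ[ℝ]} (hΦ : IsKdVDarbouxKernel Φ) (k : ℕ)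
    (i : Fin n) (p : ℝ × ℝ) :
    dirDeriv (1, 0) (fun q : ℝ × ℝ => dx k (Φ i) q.1 q.2) p = dx (k + 1) (Φ i) p.1 p.2 := by
  simp only [dx_kernel hΦ, Function.iterate_succ_apply']

theorem contDiff_wronskian {n : ℕ} {Φ : Fin n → ℝ → ℝ → ℍ[ℝ]} (hΦ : IsKdVDarbouxKernel Φ) :
    ContDiff ℝ ∞ fun p : ℝ × ℝ => wronskian Φ p.1 p.2 :=
  contDiffOn_univ.1 (contDiffOn_matrix fun i j => (contDiff_dx_kernel hΦ i j).contDiffOn)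

theorem dirDeriv_wronskian_apply {n : ℕ} {Φ : Fin n → ℝ → ℝ → ℍ[ℝ]} (hΦ : IsKdVDarbouxKernel Φ)
    (k : ℕ) (i j : Fin n) (p : ℝ × ℝ) :
    (dirDeriv (1, 0))^[k] (fun p : ℝ × ℝ => wronskian Φ p.1 p.2) p i j =
      dx (i + k) (Φ j) p.1 p.2 := by
  induction k generalizing p with
  | zero => rfl
  | succ k ih =>
    rw [Function.iterate_succ_apply', dirDeriv_apply isOpen_univ
      (contDiffOn_iterate_dirDeriv isOpen_univ (contDiff_wronskian hΦ).contDiffOn _ k) _ _ _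
      trivial]
    simp only [ih]
    exact dirDeriv_dx_kernel hΦ _ _ _

/-- The constants multiply on the right, so the closure relation survives every `x`-derivative and
holds in each row with the same `Λ`, whose `j`-th column is `α j`. -/
theorem exists_wronskian_closure {n : ℕ} {Φ : Fin n → ℝ → ℝ → ℍ[ℝ]} (hΦ : IsKdVDarbouxKernel Φ) :
    ∃ Λ : Matrix (Fin n) (Fin n) ℍ[ℝ], ∀ p : ℝ × ℝ,
      (dirDeriv (1, 0))^[2] (fun p : ℝ × ℝ => wronskian Φ p.1 p.2) p =
        wronskian Φ p.1 p.2 * Λ := by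
  choose α hα using hΦ.closure
  refine ⟨Matrix.of fun k j => α j k, fun p => Matrix.ext fun i j => ?_⟩
  rw [dirDeriv_wronskian_apply hΦ, Matrix.mul_apply, dx_kernel hΦ, Function.iterate_add_apply,
    ← iterate_dirDeriv_congr isOpen_univ (fun q _ => dx_kernel hΦ 2 j q) _ _ trivial]
  simp only [hα]
  rw [iterate_dirDeriv_sum_mul_const isOpen_univ _ (fun k => (hΦ.smooth k).contDiffOn) _ _ _
    trivial]
  simp only [wronskian, Matrix.of_apply, dx_kernel hΦ]

theorem dirDeriv_wronskian_dispersion {n : ℕ} {Φ : Fin n → ℝ → ℝ → ℍ[ℝ]}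
    (hΦ : IsKdVDarbouxKernel Φ) (p : ℝ × ℝ) :
    dirDeriv (0, 1) (fun p : ℝ × ℝ => wronskian Φ p.1 p.2) p =
      (dirDeriv (1, 0))^[3] (fun p : ℝ × ℝ => wronskian Φ p.1 p.2) p := by
  refine Matrix.ext fun i j => ?_
  have hcomm : ∀ (k : ℕ) (p : ℝ × ℝ), dirDeriv (0, 1) (fun q : ℝ × ℝ => dx k (Φ j) q.1 q.2) p =
      dx (k + 3) (Φ j) p.1 p.2 := by
    intro k
    induction k with
    | zero =>
      intro p
      rw [zero_add, hΦ.dispersion]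
      simp only [dx, iteratedDeriv_zero]
      exact (dt_eq_dirDeriv isOpen_univ (hΦ.smooth j).contDiffOn (fun _ _ => rfl) p trivial).symm
    | succ k ih =>
      intro p
      simp only [← dirDeriv_dx_kernel hΦ k]
      rw [dirDeriv_comm isOpen_univ (contDiff_dx_kernel hΦ k j).contDiffOn _ _ trivial]
      simp only [funext ih]
      rw [dirDeriv_dx_kernel hΦ, add_right_comm]
  rw [dirDeriv_wronskian_apply hΦ, dirDeriv_apply isOpen_univ
    (contDiff_wronskian hΦ).contDiffOn _ _ _ trivial]
  exact hcomm i p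

theorem isOpen_regularSet {n : ℕ} {Φ : Fin n → ℝ → ℝ → ℍ[ℝ]} (hΦ : IsKdVDarbouxKernel Φ) :
    IsOpen (regularSet Φ) := by
  have hc : Continuous fun p : ℝ × ℝ => wronskianCdet Φ p.1 p.2 := by
    refine continuous_cdet fun i j => ?_
    simp only [Matrix.mul_apply, Matrix.conjTranspose_apply]
    exact continuous_finsetSum _ fun k _ =>
      (continuous_star.comp (contDiff_dx_kernel hΦ k i).continuous).mul
        (contDiff_dx_kernel hΦ k j).continuous
  exact isOpen_ne_fun hc continuous_const

theorem isUnit_wronskian {n : ℕ} {Φ : Fin n → ℝ → ℝ → ℍ[ℝ]} {p : ℝ × ℝ}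
    (hp : p ∈ regularSet Φ) : IsUnit (wronskian Φ p.1 p.2) :=
  isUnit_of_cdet_conjTranspose_mul_ne_zero hp

/-- The logarithmic derivative `W_x W⁻¹` of the Wronskian matrix. -/
noncomputable def logDeriv {n : ℕ} (Φ : Fin n → ℝ → ℝ → ℍ[ℝ]) (p : ℝ × ℝ) :
    Matrix (Fin n) (Fin n) ℍ[ℝ] :=
  dirDeriv (1, 0) (fun p : ℝ × ℝ => wronskian Φ p.1 p.2) p * Ring.inverse (wronskian Φ p.1 p.2)

theorem contDiffOn_logDeriv {n : ℕ} {Φ : Fin n → ℝ → ℝ → ℍ[ℝ]} (hΦ : IsKdVDarbouxKernel Φ) :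
    ContDiffOn ℝ ∞ (logDeriv Φ) (regularSet Φ) :=
  (contDiffOn_dirDeriv (isOpen_regularSet hΦ) (contDiff_wronskian hΦ).contDiffOn _).mul
    (contDiffOn_ringInverse (contDiff_wronskian hΦ).contDiffOn fun _ => isUnit_wronskian)

theorem logDeriv_apply {n : ℕ} {Φ : Fin n → ℝ → ℝ → ℍ[ℝ]} (hΦ : IsKdVDarbouxKernel Φ)
    (p : ℝ × ℝ) (i j : Fin n) :
    logDeriv Φ p i j =
      ∑ k, dx (i + 1) (Φ k) p.1 p.2 * Ring.inverse (wronskian Φ p.1 p.2) k j := by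
  rw [logDeriv, Matrix.mul_apply]
  exact Finset.sum_congr rfl fun k _ => congrArg (· * _) (dirDeriv_wronskian_apply hΦ 1 i k p)

/-- By Chen's formula every summand contains the factor `cdet(W†W)`; it is real, so it commutes past
`∂ⁿφᵢ` and cancels. The sum is the last row of `W_x` times the last column of `W⁻¹`. -/
theorem chenExpression_eq {m : ℕ} {Φ : Fin (m + 1) → ℝ → ℝ → ℍ[ℝ]} (hΦ : IsKdVDarbouxKernel Φ)
    {p : ℝ × ℝ} (hp : p ∈ regularSet Φ) :
    chenExpression Φ p.1 p.2 = 2 * logDeriv Φ p (Fin.last m) (Fin.last m) := by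
  have hD : wronskianCdet Φ p.1 p.2 ≠ 0 := hp
  have hstar : star (wronskianCdet Φ p.1 p.2) = wronskianCdet Φ p.1 p.2 :=
    star_cdet (Matrix.isHermitian_conjTranspose_mul_self _)
  have hinv := Ring.mul_inverse_cancel _ (isUnit_wronskian hp)
  rw [chenExpression, logDeriv_apply hΦ, mul_assoc]
  congr 1
  rw [Finset.mul_sum]
  refine Finset.sum_congr rfl fun i _ => ?_
  rw [cdet_swapLast_mul_replaceLast hinv]
  change (wronskianCdet Φ p.1 p.2)⁻¹ * (_ * (wronskianCdet Φ p.1 p.2 * _)) = _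
  rw [← mul_assoc (dx _ _ _ _), ← mul_comm_of_star_eq hstar, mul_assoc, inv_mul_cancel_left₀ hD,
    Fin.val_last]

/-- Row `i` of `W_x` is row `i + 1` of `W`, so row `i` of `W_x W⁻¹` is a row of the identity. -/
theorem dirDeriv_logDeriv_of_ne_last {m : ℕ} {Φ : Fin (m + 1) → ℝ → ℝ → ℍ[ℝ]}
    (hΦ : IsKdVDarbouxKernel Φ) {p : ℝ × ℝ} (hp : p ∈ regularSet Φ) {i : Fin (m + 1)}
    (hi : i ≠ Fin.last m) (j : Fin (m + 1)) : dirDeriv (1, 0) (logDeriv Φ) p i j = 0 := by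
  have hU := isOpen_regularSet hΦ
  have hlt : (i : ℕ) + 1 < m + 1 := by
    have := Fin.val_lt_last hi
    omega
  rw [dirDeriv_apply hU (contDiffOn_logDeriv hΦ) _ _ _ hp]
  have hconst : Set.EqOn (fun q => logDeriv Φ q i j)
      (fun _ => (1 : Matrix (Fin (m + 1)) (Fin (m + 1)) ℍ[ℝ]) ⟨i + 1, hlt⟩ j)
      (regularSet Φ) := by
    intro q hq
    simp only [logDeriv_apply hΦ]
    rw [← Ring.mul_inverse_cancel _ (isUnit_wronskian hq), Matrix.mul_apply]
    rfl
  rw [dirDeriv_congr hU hconst _ hp, dirDeriv_const]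

theorem potential_kdv_logDeriv {m : ℕ} {Φ : Fin (m + 1) → ℝ → ℝ → ℍ[ℝ]}
    (hΦ : IsKdVDarbouxKernel Φ) {p : ℝ × ℝ} (hp : p ∈ regularSet Φ) :
    4 * dirDeriv (0, 1) (fun q => logDeriv Φ q (Fin.last m) (Fin.last m)) p =
      dirDeriv (1, 0) (dirDeriv (1, 0) (dirDeriv (1, 0)
        (fun q => logDeriv Φ q (Fin.last m) (Fin.last m)))) p
      + 6 * (dirDeriv (1, 0) (fun q => logDeriv Φ q (Fin.last m) (Fin.last m)) p
        * dirDeriv (1, 0) (fun q => logDeriv Φ q (Fin.last m) (Fin.last m)) p) := by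
  have hU := isOpen_regularSet hΦ
  have hX := contDiffOn_logDeriv hΦ
  have hX1 := contDiffOn_dirDeriv hU hX (1, 0)
  have hX2 := contDiffOn_dirDeriv hU hX1 (1, 0)
  obtain ⟨Λ, hΛ⟩ := exists_wronskian_closure hΦ
  have h := potential_kdv_of_linear hU (contDiff_wronskian hΦ).contDiffOn hX
    (fun _ => isUnit_wronskian)
    (fun q hq => by rw [logDeriv, mul_assoc, Ring.inverse_mul_cancel _ (isUnit_wronskian hq),
      mul_one])
    (fun q _ => hΛ q) (fun q _ => dirDeriv_wronskian_dispersion hΦ q) hp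
  have h' := congrFun (congrFun h (Fin.last m)) (Fin.last m)
  have n4 : ∀ M : Matrix (Fin (m + 1)) (Fin (m + 1)) ℍ[ℝ], 4 * M = (4 : ℕ) • M := fun M => by
    rw [nsmul_eq_mul]; rfl
  have n6 : ∀ M : Matrix (Fin (m + 1)) (Fin (m + 1)) ℍ[ℝ], 6 * M = (6 : ℕ) • M := fun M => by
    rw [nsmul_eq_mul]; rfl
  -- Only the last row of `X_x` is nonzero, so a single term of the matrix product survives.
  rw [n4, n6, Matrix.add_apply, Matrix.smul_apply, Matrix.smul_apply, Matrix.mul_apply,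
    Finset.sum_eq_single (Fin.last m)
      (fun k _ hk => by rw [dirDeriv_logDeriv_of_ne_last hΦ hp hk, mul_zero]) (by simp),
    nsmul_eq_mul, nsmul_eq_mul, dirDeriv_apply hU hX _ _ _ hp, dirDeriv_apply hU hX _ _ _ hp,
    dirDeriv_apply hU hX2 _ _ _ hp,
    dirDeriv_congr hU (fun q hq => dirDeriv_apply hU hX1 _ _ _ hq) _ hp,
    dirDeriv_congr hU (dirDeriv_congr hU (fun q hq => dirDeriv_apply hU hX _ _ _ hq) _) _ hp] at h'
  exact_mod_cast h'

theorem contDiffOn_logDeriv_last {m : ℕ} {Φ : Fin (m + 1) → ℝ → ℝ → ℍ[ℝ]}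
    (hΦ : IsKdVDarbouxKernel Φ) :
    ContDiffOn ℝ ∞ (fun p => logDeriv Φ p (Fin.last m) (Fin.last m)) (regularSet Φ) :=
  (entryCLM (m + 1) (Fin.last m) (Fin.last m)).contDiff.comp_contDiffOn (contDiffOn_logDeriv hΦ)

theorem uPhi_eq {m : ℕ} {Φ : Fin (m + 1) → ℝ → ℝ → ℍ[ℝ]} (hΦ : IsKdVDarbouxKernel Φ)
    {p : ℝ × ℝ} (hp : p ∈ regularSet Φ) :
    uPhi Φ p.1 p.2 =
      2 * dirDeriv (1, 0) (fun q => logDeriv Φ q (Fin.last m) (Fin.last m)) p := by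
  have hU := isOpen_regularSet hΦ
  have ha := contDiffOn_logDeriv_last hΦ
  rw [← dirDeriv_const_mul hU ha 2 _ hp]
  exact dx_eq_iterate_dirDeriv hU (contDiffOn_const.mul ha)
    (fun q hq => chenExpression_eq hΦ hq) 1 p hp

theorem mem_regularSet_fin_one {φ : ℝ → ℝ → ℍ[ℝ]} {x t : ℝ} :
    (x, t) ∈ regularSet (fun _ : Fin 1 => φ) ↔ φ x t ≠ 0 := by
  have h : wronskianCdet (fun _ : Fin 1 => φ) x t = star (φ x t) * φ x t := by
    rw [wronskianCdet, cdet_fin_one, Matrix.mul_apply]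
    simp [wronskian, dx]
  change wronskianCdet (fun _ : Fin 1 => φ) x t ≠ 0 ↔ _
  rw [h, mul_ne_zero_iff, star_ne_zero, and_self]

theorem uPhi_fin_one {φ : ℝ → ℝ → ℍ[ℝ]} (hφ : IsKdVDarbouxKernel (fun _ : Fin 1 => φ)) {x t : ℝ}
    (h : φ x t ≠ 0) :
    uPhi (fun _ : Fin 1 => φ) x t =
      2 * dx 2 φ x t * (φ x t)⁻¹ - 2 * dx 1 φ x t * (φ x t)⁻¹ * dx 1 φ x t * (φ x t)⁻¹ := by
  have hU := isOpen_regularSet hφ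
  have hp : (x, t) ∈ regularSet (fun _ : Fin 1 => φ) := mem_regularSet_fin_one.2 h
  have hX := contDiffOn_logDeriv_last hφ
  set X : ℝ × ℝ → ℍ[ℝ] := fun q => logDeriv (fun _ : Fin 1 => φ) q (Fin.last 0) (Fin.last 0)
    with hX_def
  have hXφ : ∀ q ∈ regularSet (fun _ : Fin 1 => φ), X q * φ q.1 q.2 = dx 1 φ q.1 q.2 := by
    intro q hq
    have h0 := Ring.inverse_mul_cancel _ (isUnit_wronskian hq)
    have h1 := congrFun (congrFun h0 0) 0
    rw [Matrix.mul_apply] at h1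
    simp only [Fin.isValue, Finset.univ_unique, Fin.default_eq_zero, Finset.sum_singleton,
      Matrix.one_apply_eq, wronskian, Matrix.of_apply, Fin.val_zero, dx, iteratedDeriv_zero] at h1
    rw [hX_def]
    simp only [logDeriv_apply hφ, Finset.univ_unique, Finset.sum_singleton]
    rw [mul_assoc]
    refine Eq.trans (congrArg _ h1) ?_
    simp
  have hXe : X (x, t) = dx 1 φ x t * (φ x t)⁻¹ := by
    rw [eq_mul_inv_iff_mul_eq₀ h, hXφ _ hp]
  -- The `x`-derivative of `Xφ = φ_x`, to be solved for `X_x`.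
  have hd : dirDeriv (1, 0) X (x, t) * φ x t + X (x, t) * dx 1 φ x t = dx 2 φ x t := by
    have h1 := dirDeriv_mul hU hX (hφ.smooth 0).contDiffOn (1, 0) hp
    rw [dirDeriv_congr hU hXφ _ hp, dirDeriv_dx_kernel hφ 1 0 (x, t)] at h1
    rw [h1]
    congr 2
    exact dx_kernel hφ 1 0 (x, t)
  rw [uPhi_eq hφ hp, (eq_mul_inv_iff_mul_eq₀ h).2 (eq_sub_of_add_eq hd), hXe]
  noncomm_ring

end Darboux

end QKdV

theorem theorem1 :
    (∀ (m : ℕ) (Φ : Fin (m + 1) → ℝ → ℝ → ℍ[ℝ]), QKdV.IsKdVDarbouxKernel Φ →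
      ContDiffOn ℝ ∞ (fun p : ℝ × ℝ => QKdV.chenExpression Φ p.1 p.2) (QKdV.regularSet Φ) ∧
      QKdV.IsKdVSolutionOn (QKdV.uPhi Φ) (QKdV.regularSet Φ)) ∧
    (∀ φ : ℝ → ℝ → ℍ[ℝ], QKdV.IsKdVDarbouxKernel (fun _ : Fin 1 => φ) →
      ∀ x t : ℝ,
        ((x, t) ∈ QKdV.regularSet (fun _ : Fin 1 => φ) ↔ φ x t ≠ 0) ∧
        (φ x t ≠ 0 →
          QKdV.uPhi (fun _ : Fin 1 => φ) x t =
            2 * QKdV.dx 2 φ x t * (φ x t)⁻¹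
              - 2 * QKdV.dx 1 φ x t * (φ x t)⁻¹ * QKdV.dx 1 φ x t * (φ x t)⁻¹)) := by
  refine ⟨fun m Φ hΦ => ⟨?_, ?_⟩, fun φ hφ x t =>
    ⟨QKdV.mem_regularSet_fin_one, QKdV.uPhi_fin_one hφ⟩⟩
  · exact (contDiffOn_const.mul (QKdV.contDiffOn_logDeriv_last hΦ)).congr
      fun p hp => QKdV.chenExpression_eq hΦ hp
  · exact QKdV.isKdVSolutionOn_of_potential (QKdV.isOpen_regularSet hΦ)
      (QKdV.contDiffOn_logDeriv_last hΦ) (fun p hp => QKdV.potential_kdv_logDeriv hΦ hp)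
      fun p hp => QKdV.uPhi_eq hΦ hp
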